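/- Let $V$ be a finite-dimensional real vector space with a Lebesgue measure $dx$, and let $X=[a_1,\dots,a_m]$ be a list of non-zero vectors spanning $V$. A subspace of $V$ is *rational* if it is spanned by a sublist of $X$; $S_X$ is the set of rational subspaces. $X\cap r$ and $X\setminus r$ are the sublists of elements lying, respectively not lying, in $r$. For a sublist $Y$ put $\partial_Y=\prod_{a\in Y}\partial_a$. Let $\mathcal D(V)$ be the space of (real or complex) distributions on $V$, and let $\mathcal D(V,r)$ be the set of those that vanish on every test function vanishing on $r$ (identified with the distributions on $r$). Define $$G(X)=\{f\in\mathcal D(V):\ \partial_{X\setminus r}f\in\mathcal D(V,r)\ \text{ for all } r\in S_X\},$$ and, for $r\in S_X$, let $D(X\cap r)$ be the set of $g\in\mathcal D(V,r)$ with $\partial_Y g=0$ for every cocircuit $Y$ of $X\cap r$, i.e. every minimal sublist $Y$ of $X\cap r$ such that $(X\cap r)\setminus Y$ does not span $r$. In particular $D(X)=D(X\cap V)$. A *regular face* for $X\setminus r$ is an open face $F_r$ in $r^\perp\subset V^*$ of the arrangement of hyperplanes $\{u\in r^\perp:\langle u,a\rangle=0\}$, $a\in X\setminus r$. Let $A$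 and $B$ be the sublists of $X\setminus r$ on which $F_r$ is positive, respectively negative, and let $T_{X\setminus r}^{F_r}=(-1)^{|B|}T_{[A,-B]}$, where for a list $[c_1,\dots,c_k]$ $$\langle T_{[c_1,\dots,c_k]},\varphi\rangle=\int_0^\infty\!\!\cdots\int_0^\infty\varphi\Big(\sum_i t_ic_i\Big)\,dt_1\cdots dt_k .$$ An *$X$-regular collection* is a family $\mathbf F=(F_r)_{r\in S_X}$ of regular faces $F_r$ for $X\setminus r$. An *$\mathbf F$-decomposition* of $f$ is an expression $f=\sum_{r\in S_X}f_r$ with $f_r\in T_{X\setminus r}^{F_r}*D(X\cap r)$ for every $r\in S_X$. A *tope* is a connected component of the complement in $V$ of the union of the hyperplanes spanned by sublists of $X$. The collection $\mathbf F$ is *non-positive* on a tope $\tau$ if for every proper rational subspace $r$ there are $u\in F_r$ and $x\in\tau$ with $\langle u,x\rangle<0$. **Proposition (Localization theorem).** Let $f\in G(X)$, let $\tau$ be a tope and let $\mathbf F$ be an $X$-regular collection that is non-positive on $\tau$. Then $f$ has a unique $\mathbf F$-decomposition $f=\sum_{r\in S_X}f_r$, and its component $f_V$ lies in $D(X)$,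 is a polynomial density $P(x)\,dx$ on $V$ with $P$ a polynomial, and satisfies $f=f_V$ on $\tau$, that is, $\langle f,\varphi\rangle=\langle f_V,\varphi\rangle$ for every test function $\varphi$ with support in $\tau$. -/

import Mathlib

open scoped Distributions LineDeriv

section Translation

variable {V : Type*} [NormedAddCommGroup V] [NormedSpace ℝ V]

/-- The translated test function `y ↦ φ (x + y)`. -/
noncomputable def translateTest (x : V) (φ : 𝓓((⊤ : TopologicalSpace.Opens V), ℝ)) :
    𝓓((⊤ : TopologicalSpace.Opens V), ℝ) where
  toFun y := φ (x + y)
  contDiff' := φ.contDiff.comp (contDiff_const.add contDiff_id)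
  hasCompactSupport' := φ.hasCompactSupport.comp_homeomorph (Homeomorph.addLeft x)
  tsupport_subset' := fun _ _ => trivial

end Translation

section Derivatives

variable {𝕜 : Type*} [RCLike 𝕜] {V : Type*} [NormedAddCommGroup V] [NormedSpace ℝ V]

theorem lineDeriv_test_comm (v w : V) (φ : 𝓓((⊤ : TopologicalSpace.Opens V), ℝ)) :
    ∂_{v} (∂_{w} φ) = ∂_{w} (∂_{v} φ) := by
  have key : ∀ (v w : V) (x : V),
      (∂_{v} (∂_{w} φ) : 𝓓((⊤ : TopologicalSpace.Opens V), ℝ)) x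
        = fderiv ℝ (fderiv ℝ φ) x v w := by
    intro v w x
    have h1 : ∀ u : V, ∀ ψ : 𝓓((⊤ : TopologicalSpace.Opens V), ℝ), ∀ y,
        (∂_{u} ψ : 𝓓((⊤ : TopologicalSpace.Opens V), ℝ)) y = fderiv ℝ ψ y u := by
      intro u ψ y
      rw [TestFunction.lineDerivOp_eq_lineDerivCLM ℝ, TestFunction.lineDerivCLM_eq_fderivCLM,
        TestFunction.fderivCLM_apply_of_le _ (by simp)]
    have h2 : ((∂_{w} φ : 𝓓((⊤ : TopologicalSpace.Opens V), ℝ)) : V → ℝ)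
        = fun y => fderiv ℝ φ y w := funext (h1 w φ)
    have h3 : DifferentiableAt ℝ (fderiv ℝ φ) x :=
      ((φ.contDiff.fderiv_right (m := 1) (by decide)).differentiable
        (by simp)) x
    rw [h1, h2, fderiv_clm_apply h3 (differentiableAt_const w)]
    simp
  ext x
  rw [key, key]
  exact (φ.contDiff.contDiffAt.isSymmSndFDerivAt (by simp; decide)).eq v w

theorem lineDeriv_distribution_comm (v w : V)
    (T : 𝓓'((⊤ : TopologicalSpace.Opens V), 𝕜)) :
    ∂_{v} (∂_{w} T) = ∂_{w} (∂_{v} T) := by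
  ext φ
  simp only [Distribution.lineDerivOp_apply_apply, map_neg, neg_neg]
  rw [lineDeriv_test_comm]

/-- The directional derivative `∂_v` as a linear operator on distributions. -/
noncomputable def dirDeriv (𝕜 : Type*) [RCLike 𝕜] (v : V) :
    Module.End ℝ 𝓓'((⊤ : TopologicalSpace.Opens V), 𝕜) :=
  (LineDeriv.lineDerivOpCLM ℝ 𝓓'((⊤ : TopologicalSpace.Opens V), 𝕜) v).toLinearMap

theorem dirDeriv_commute (𝕜 : Type*) [RCLike 𝕜] {ι : Type*} (X : ι → V) (s : Set ι) :
    s.Pairwise (Function.onFun Commute fun i => dirDeriv 𝕜 (X i)) :=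
  fun i _ j _ _ => LinearMap.ext fun T => lineDeriv_distribution_comm (X i) (X j) T

end Derivatives

noncomputable section

/-! Throughout, a list `X` of vectors is a finite family `X : ι → V`, and a sublist is a finite set
of indices. -/

section Combinatorics

variable {V : Type*} [NormedAddCommGroup V] [NormedSpace ℝ V] {ι : Type*} [Fintype ι]

/-- The subspace spanned by a sublist. -/
def spanOf (X : ι → V) (S : Finset ι) : Submodule ℝ V :=
  Submodule.span ℝ (X '' (S : Set ι))

open Classical in
/-- The sublist `X ∩ r`. -/
def insideList (X : ι → V) (r : Submodule ℝ V) : Finset ι :=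
  Finset.univ.filter fun i => X i ∈ r

open Classical in
/-- The sublist `X \ r`. -/
def outsideList (X : ι → V) (r : Submodule ℝ V) : Finset ι :=
  Finset.univ.filter fun i => X i ∉ r

open Classical in
/-- The finite set of rational subspaces: the spans of the sublists of `X`. -/
def rationalSubspaces (X : ι → V) : Finset (Submodule ℝ V) :=
  Finset.univ.image fun S : Finset ι => spanOf X S

theorem top_mem_rationalSubspaces {X : ι → V} (hX : Submodule.span ℝ (Set.range X) = ⊤) :
    ⊤ ∈ rationalSubspaces X := by
  classical
  refine Finset.mem_image.2 ⟨Finset.univ, Finset.mem_univ _, ?_⟩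
  simpa [spanOf] using hX

open Classical in
/-- `Y` is a cocircuit of the sublist `S`: it is minimal among the sublists of `S` whose complement
in `S` does not span the space spanned by `S`. -/
def IsCocircuit (X : ι → V) (S Y : Finset ι) : Prop :=
  Minimal (fun Z : Finset ι => Z ⊆ S ∧ spanOf X (S \ Z) ≠ spanOf X S) Y

/-- The complement of the union of the hyperplanes spanned by sublists of `X`. -/
def topeRegion (X : ι → V) : Set V :=
  {x | ∀ H ∈ rationalSubspaces X, Module.finrank ℝ H + 1 = Module.finrank ℝ V → x ∉ H}

/-- Topes are the connected components of this complement. -/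
def IsTope (X : ι → V) (τ : Set V) : Prop :=
  ∃ x ∈ topeRegion X, τ = connectedComponentIn (topeRegion X) x

/-- `F` is an open face, in the annihilator of `r`, of the arrangement of hyperplanes defined by
`X \ r`: the set of all linear forms vanishing on `r` that have the same sign on each element of
`X \ r` as a given linear form without zeros on `X \ r`. -/
def IsRegularFace (X : ι → V) (r : Submodule ℝ V) (F : Set (Module.Dual ℝ V)) : Prop :=
  ∃ u ∈ r.dualAnnihilator, (∀ i ∈ outsideList X r, u (X i) ≠ 0) ∧
    F = {w | w ∈ r.dualAnnihilator ∧
      ∀ i ∈ outsideList X r, SignType.sign (w (X i)) = SignType.sign (u (X i))}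

/-- An `X`-regular collection: a regular face for every rational subspace (the values of `F` at
other subspaces play no role). -/
def IsRegularCollection (X : ι → V) (F : Submodule ℝ V → Set (Module.Dual ℝ V)) : Prop :=
  ∀ r ∈ rationalSubspaces X, IsRegularFace X r (F r)

/-- The collection `F` is non-positive on `τ`. -/
def IsNonPositiveOn (X : ι → V) (F : Submodule ℝ V → Set (Module.Dual ℝ V)) (τ : Set V) : Prop :=
  ∀ r ∈ rationalSubspaces X, r ≠ ⊤ → ∃ u ∈ F r, ∃ x ∈ τ, u x < 0

open Classical in
/-- The elements `B` of `X \ r` on which the face `F` is negative. -/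
def negativeList (X : ι → V) (r : Submodule ℝ V) (F : Set (Module.Dual ℝ V)) : Finset ι :=
  (outsideList X r).filter fun i => ∀ u ∈ F, u (X i) < 0

open Classical in
/-- The vectors of the list `[A, -B]`: the elements of `X \ r` on which `F` is negative are
replaced by their opposites. -/
def flippedFamily (X : ι → V) (r : Submodule ℝ V) (F : Set (Module.Dual ℝ V)) (i : ι) : V :=
  if i ∈ negativeList X r F then - X i else X i

end Combinatorics

section Distributions

variable {𝕜 : Type*} [RCLike 𝕜] {V : Type*} [NormedAddCommGroup V] [NormedSpace ℝ V]
  {ι : Type*} [Fintype ι]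

/-- The operator `∂_Y`, the product of the directional derivatives along the elements of the
sublist `Y`, acting on distributions. -/
def derivAlong (𝕜 : Type*) [RCLike 𝕜] (X : ι → V) (Y : Finset ι) :
    Module.End ℝ 𝓓'((⊤ : TopologicalSpace.Opens V), 𝕜) :=
  Y.noncommProd (fun i => dirDeriv 𝕜 (X i)) (dirDeriv_commute 𝕜 X Y)

/-- The distributions on `V` that vanish on all test functions vanishing on `r`; restriction of
test functions to `r` identifies them with the distributions on `r`. -/
def distOn (𝕜 : Type*) [RCLike 𝕜] (r : Submodule ℝ V) :
    Set 𝓓'((⊤ : TopologicalSpace.Opens V), 𝕜) :=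
  {T | ∀ φ : 𝓓((⊤ : TopologicalSpace.Opens V), ℝ), (∀ x ∈ r, φ x = 0) → T φ = 0}

/-- The Dahmen-Micchelli space `D(S)` of a sublist `S` of `X`: the distributions on the span of `S`
annihilated by `∂_Y` for all cocircuits `Y` of `S`. The space `D(X)` is the case
`S = Finset.univ`. -/
def dahmenMicchelli (𝕜 : Type*) [RCLike 𝕜] (X : ι → V) (S : Finset ι) :
    Set 𝓓'((⊤ : TopologicalSpace.Opens V), 𝕜) :=
  {g | g ∈ distOn 𝕜 (spanOf X S) ∧ ∀ Y, IsCocircuit X S Y → derivAlong 𝕜 X Y g = 0}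

/-- The space `G(X)`. -/
def spaceG (𝕜 : Type*) [RCLike 𝕜] (X : ι → V) : Set 𝓓'((⊤ : TopologicalSpace.Opens V), 𝕜) :=
  {f | ∀ r ∈ rationalSubspaces X, derivAlong 𝕜 X (outsideList X r) f ∈ distOn 𝕜 r}

variable [MeasurableSpace V]

/-- The multivariate spline `T_{[c i, i ∈ S]}` as a positive measure: the image of Lebesgue measure
on the orthant `t ≥ 0` under `t ↦ ∑ t_i c_i`, so that it integrates `φ` to
`∫_{t ≥ 0} φ (∑ t_i c_i) dt`. -/
def splineMeasure (S : Finset ι) (c : ι → V) : MeasureTheory.Measure V :=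
  ((MeasureTheory.volume : MeasureTheory.Measure (S → ℝ)).restrict (Set.Ici 0)).map
    fun t => ∑ i : S, t i • c i

/-- `h` is the convolution `T * g`, where `T = (-1)^{|B|} T_{[A, -B]}` is the spline attached to
`X \ r` and the face `F`; that is, `⟨T * g, φ⟩ = ⟨T_x, ⟨g_y, φ (x + y)⟩⟩`, where the outer pairing is
an absolutely convergent integral. -/
def IsSplineConvolution (X : ι → V) (r : Submodule ℝ V) (F : Set (Module.Dual ℝ V))
    (g h : 𝓓'((⊤ : TopologicalSpace.Opens V), 𝕜)) : Prop :=
  ∀ φ : 𝓓((⊤ : TopologicalSpace.Opens V), ℝ),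
    MeasureTheory.Integrable (fun x => g (translateTest x φ))
      (splineMeasure (outsideList X r) (flippedFamily X r F)) ∧
    h φ = (-1) ^ (negativeList X r F).card *
      ∫ x, g (translateTest x φ) ∂(splineMeasure (outsideList X r) (flippedFamily X r F))

/-- The `F`-component `T_{X \ r}^F * D(X ∩ r)`. -/
def faceComponent (𝕜 : Type*) [RCLike 𝕜] (X : ι → V) (r : Submodule ℝ V)
    (F : Set (Module.Dual ℝ V)) : Set 𝓓'((⊤ : TopologicalSpace.Opens V), 𝕜) :=
  {h | ∃ g ∈ dahmenMicchelli 𝕜 X (insideList X r), IsSplineConvolution X r F g h}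

/-- The family `c` is an `F`-decomposition of `f`. -/
def IsFaceDecomposition (X : ι → V) (F : Submodule ℝ V → Set (Module.Dual ℝ V))
    (f : 𝓓'((⊤ : TopologicalSpace.Opens V), 𝕜))
    (c : {r // r ∈ rationalSubspaces X} → 𝓓'((⊤ : TopologicalSpace.Opens V), 𝕜)) : Prop :=
  (∀ r, c r ∈ faceComponent 𝕜 X r.1 (F r.1)) ∧ f = ∑ r, c r

/-- `g` is a polynomial density `P(x) dμ(x)`, where `P` is a polynomial in linear forms on `V`. -/
def IsPolynomialDensity (μ : MeasureTheory.Measure V)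
    (g : 𝓓'((⊤ : TopologicalSpace.Opens V), 𝕜)) : Prop :=
  ∃ P : MvPolynomial (Module.Dual ℝ V) 𝕜, ∀ φ : 𝓓((⊤ : TopologicalSpace.Opens V), ℝ),
    g φ = ∫ x, φ x • MvPolynomial.eval (fun l : Module.Dual ℝ V => ((l x : ℝ) : 𝕜)) P ∂μ

end Distributions

end

open TopologicalSpace MeasureTheory Filter Topology

/-! For a rational subspace $r$, the operators $\partial_{X\setminus r}$ act triangularly on the
face components, and this gives existence and uniqueness together. Let $h=T_{X\setminus r}^{F_r}*g$
with $g\in D(X\cap r)$. Each derivative along an element of $X\setminus r$ removes that element from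
the spline, so $\partial_{X\setminus r}h=g$ (`IsSplineConvolution.derivAlong_outsideList`). If
$r\not\le r'$, then $X\setminus r'$ contains a cocircuit of $X\cap r$ and $\partial_{X\setminus
r'}h=0$ (`derivAlong_faceComponent_eq_zero`). If $r\le r'$, the part of the spline that is left
lives in $r'$, so $h\in G(X)$.

For existence, `exists_sum_faceComponents` takes $r$ minimal among the subspaces not yet treated.
Minimality forces $\partial_{X\setminus r}f$ into $D(X\cap r)$; subtracting its convolution with the
spline stays in $G(X)$ and removes $r$ from the list. For uniqueness, a minimal nonzero component of
a difference is detected by its own operator.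

An element of $D(X)$ is killed by all sufficiently long products of derivatives, because a sublist
that does not span has a complement containing a cocircuit. Such a distribution is polynomial
(`DerivsVanish.isPolynomialDensity`): its pairing with translates of a test function is a polynomial
in the translation, so it kills every test function orthogonal to the monomials of low degree and is
a finite combination of moments.

For localization, $f_r$ is carried by the closed cone $r+\mathrm{cone}(A,-B)$. Within the complement
of the rational hyperplanes this cone is also open, so a tope lies inside it or misses it. The forms
in $F_r$ are nonnegative on the cone, so non-positivity leaves only the second case for $r\ne V$
(`disjoint_tope_faceCone`), and on $\tau$ only $f_V$ survives. -/

/-- Real-valued test functions on a normed space. -/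
abbrev Test (V : Type*) [NormedAddCommGroup V] [NormedSpace ℝ V] := 𝓓((⊤ : Opens V), ℝ)

/-- Distributions on a normed space. -/
abbrev DistOver (V 𝕜 : Type*) [NormedAddCommGroup V] [NormedSpace ℝ V] [RCLike 𝕜] :=
  𝓓'((⊤ : Opens V), 𝕜)

/-! ### Test functions: translates, derivatives and uniform estimates -/

section TestFunctions

variable {V : Type*} [NormedAddCommGroup V] [NormedSpace ℝ V]

@[simp] theorem translateTest_apply (x : V) (φ : Test V) (y : V) :
    translateTest x φ y = φ (x + y) := rfl

theorem translateTest_add (x : V) (φ ψ : Test V) :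
    translateTest x (φ + ψ) = translateTest x φ + translateTest x ψ := by
  ext y; rfl

theorem translateTest_smul (x : V) (a : ℝ) (φ : Test V) :
    translateTest x (a • φ) = a • translateTest x φ := by
  ext y; rfl

theorem translateTest_zero (φ : Test V) : translateTest 0 φ = φ := by
  ext y; simp

theorem lineDeriv_test_apply (v : V) (φ : Test V) (x : V) :
    (∂_{v} φ : Test V) x = fderiv ℝ φ x v := by
  rw [TestFunction.lineDerivOp_eq_lineDerivCLM ℝ, TestFunction.lineDerivCLM_eq_fderivCLM,
    TestFunction.fderivCLM_apply_of_le _ (by simp)]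

theorem iteratedFDeriv_translateTest (i : ℕ) (x : V) (φ : Test V) (y : V) :
    iteratedFDeriv ℝ i (translateTest x φ) y = iteratedFDeriv ℝ i φ (x + y) :=
  iteratedFDeriv_comp_add_left i x y

theorem translateTest_lineDeriv (x v : V) (φ : Test V) :
    translateTest x (∂_{v} φ) = ∂_{v} (translateTest x φ) := by
  ext y
  rw [translateTest_apply, lineDeriv_test_apply, lineDeriv_test_apply]
  exact congrArg (fun L : V →L[ℝ] ℝ => L v) (fderiv_comp_add_left x).symm

theorem test_contDiff (φ : Test V) : ContDiff ℝ (⊤ : ℕ∞) φ := φ.contDiff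

theorem test_continuous_iteratedFDeriv (φ : Test V) (i : ℕ) :
    Continuous (iteratedFDeriv ℝ i φ) :=
  (test_contDiff φ).continuous_iteratedFDeriv (by exact_mod_cast le_top)

theorem test_uniformContinuous_iteratedFDeriv (φ : Test V) (i : ℕ) :
    UniformContinuous (iteratedFDeriv ℝ i φ) :=
  (φ.hasCompactSupport.iteratedFDeriv i).uniformContinuous_of_continuous
    (test_continuous_iteratedFDeriv φ i)

theorem test_exists_bound (φ : Test V) (N : ℕ) :
    ∃ B, 0 ≤ B ∧ ∀ i ≤ N, ∀ x, ‖iteratedFDeriv ℝ i φ x‖ ≤ B := by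
  have h : ∀ i, ∃ B, ∀ x, ‖iteratedFDeriv ℝ i φ x‖ ≤ B := fun i =>
    (test_continuous_iteratedFDeriv φ i).bounded_above_of_compact_support
      (φ.hasCompactSupport.iteratedFDeriv i)
  choose B hB using h
  refine ⟨∑ i ∈ Finset.range (N + 1), |B i|, Finset.sum_nonneg fun _ _ => abs_nonneg _, ?_⟩
  intro i hi x
  refine (hB i x).trans ((le_abs_self _).trans ?_)
  exact Finset.single_le_sum (f := fun i => |B i|) (fun _ _ => abs_nonneg _)
    (Finset.mem_range.2 (by omega))

/-- Small translations change the derivatives up to order `N` uniformly little. -/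
theorem eventually_norm_iteratedFDeriv_translate_sub_le (φ : Test V) (N : ℕ) {ε : ℝ}
    (hε : 0 < ε) :
    ∃ δ > 0, ∀ x x' : V, ‖x - x'‖ < δ → ∀ i ≤ N, ∀ y,
      ‖iteratedFDeriv ℝ i φ (x + y) - iteratedFDeriv ℝ i φ (x' + y)‖ ≤ ε := by
  have h : ∀ i, ∃ δ > 0, ∀ x x' : V, ‖x - x'‖ < δ → ∀ y,
      ‖iteratedFDeriv ℝ i φ (x + y) - iteratedFDeriv ℝ i φ (x' + y)‖ ≤ ε := by
    intro i
    obtain ⟨δ, hδ, h⟩ :=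
      Metric.uniformContinuous_iff.1 (test_uniformContinuous_iteratedFDeriv φ i) ε hε
    refine ⟨δ, hδ, fun x x' hx y => ?_⟩
    rw [← dist_eq_norm]
    exact (h (by simpa [dist_eq_norm] using hx)).le
  choose δ hδ h using h
  have hne : (Finset.range (N + 1)).Nonempty := ⟨0, by simp⟩
  refine ⟨(Finset.range (N + 1)).inf' hne δ, (Finset.lt_inf'_iff hne).2 fun i _ => hδ i, ?_⟩
  intro x x' hx i hi
  exact h i x x' (hx.trans_le (Finset.inf'_le _ (Finset.mem_range.2 (by omega))))

/-- Induction on the order; the step exchanges the two outermost derivatives by the symmetry of the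
second derivative of `iteratedFDeriv ℝ i f`. -/
theorem fderiv_iteratedFDeriv_apply (i : ℕ) {f : V → ℝ} (hf : ContDiff ℝ (⊤ : ℕ∞) f) (c : V) :
    (fun x => fderiv ℝ (iteratedFDeriv ℝ i f) x c)
      = iteratedFDeriv ℝ i (fun x => fderiv ℝ f x c) := by
  have hsm : ∀ j, ContDiff ℝ (⊤ : ℕ∞) (iteratedFDeriv ℝ j f) := fun j =>
    hf.iteratedFDeriv_right (by exact_mod_cast le_top)
  induction i with
  | zero =>
    ext x m
    have h1 : iteratedFDeriv ℝ 0 f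
        = (continuousMultilinearCurryFin0 ℝ V ℝ).symm ∘ f := iteratedFDeriv_zero_eq_comp
    rw [h1, LinearIsometryEquiv.comp_fderiv]
    simp
  | succ i ih =>
    ext x m
    rw [iteratedFDeriv_succ_apply_left, ← ih]
    have hd : DifferentiableAt ℝ (fderiv ℝ (iteratedFDeriv ℝ i f)) x :=
      (((hsm i).fderiv_right (m := 1) (by decide)).differentiable
        (by simp)) x
    have hd' : DifferentiableAt ℝ (iteratedFDeriv ℝ (i + 1) f) x :=
      ((hsm (i + 1)).differentiable (by simp)) x
    have h1 := ((ContinuousMultilinearMap.apply ℝ (fun _ : Fin (i + 1) => V) ℝ m).hasFDerivAt.comp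
      x hd'.hasFDerivAt).fderiv
    have h2 := ((ContinuousMultilinearMap.apply ℝ (fun _ : Fin i => V) ℝ
      (Fin.tail m)).hasFDerivAt.comp x
      (hd.hasFDerivAt.clm_apply (hasFDerivAt_const (m 0) x))).fderiv
    have h3 := h1.symm.trans h2
    refine (congrArg (fun L : V →L[ℝ] ℝ => L c) h3).trans ?_
    rw [fderiv_clm_apply hd (differentiableAt_const c)]
    have hsymm := (((hsm i).contDiffAt (x := x)).isSymmSndFDerivAt
      (by simp; decide)).eq c (m 0)
    simp [hsymm]

theorem hasDerivAt_iteratedFDeriv_test (φ : Test V) (i : ℕ) (y c : V) (t : ℝ) :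
    HasDerivAt (fun s : ℝ => iteratedFDeriv ℝ i φ (s • c + y))
      (iteratedFDeriv ℝ i (∂_{c} φ : Test V) (t • c + y)) t := by
  have h1 : HasDerivAt (fun s : ℝ => s • c + y) c t := by
    simpa using ((hasDerivAt_id t).smul_const c).add_const y
  have hsm : ContDiff ℝ (⊤ : ℕ∞) (iteratedFDeriv ℝ i φ) :=
    (test_contDiff φ).iteratedFDeriv_right (by exact_mod_cast le_top)
  have h2 : HasFDerivAt (iteratedFDeriv ℝ i φ)
      (fderiv ℝ (iteratedFDeriv ℝ i φ) (t • c + y)) (t • c + y) :=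
    ((hsm.differentiable (by simp)) _).hasFDerivAt
  have h3 := h2.comp_hasDerivAt t h1
  have h4 : ((∂_{c} φ : Test V) : V → ℝ) = fun x => fderiv ℝ φ x c :=
    funext (lineDeriv_test_apply c φ)
  rw [h4, ← fderiv_iteratedFDeriv_apply i (test_contDiff φ) c]
  exact h3

end TestFunctions

/-! ### Distributions as functionals of finite order on compact sets -/

section Bounds

variable {𝕜 : Type*} [RCLike 𝕜] {V : Type*} [NormedAddCommGroup V] [NormedSpace ℝ V]

/-- Continuity on functions supported in `K` is domination by finitely many seminorms. The free
bound `B` replaces the seminorms, so that pointwise estimates of derivatives can be fed in directly.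
-/
theorem DistOver.exists_bound (g : DistOver V 𝕜) {K : Set V} (hK : IsCompact K) :
    ∃ (N : ℕ) (C : ℝ), 0 ≤ C ∧ ∀ (φ : Test V) (B : ℝ), (∀ x ∉ K, φ x = 0) →
      (∀ i ≤ N, ∀ x, ‖iteratedFDeriv ℝ i φ x‖ ≤ B) → ‖g φ‖ ≤ C * B := by
  let K' : Compacts V := ⟨K, hK⟩
  have hsub : (K' : Set V) ⊆ (⊤ : Opens V) := fun _ _ => trivial
  let L : 𝓓_{K'}(V, ℝ) →ₗ[ℝ] 𝕜 := g.toLinearMap ∘ₗ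
    (TestFunction.ofSupportedInCLM (n := ⊤) (F := ℝ) ℝ hsub).toLinearMap
  have hL : Continuous L := g.continuous.comp (TestFunction.continuous_ofSupportedIn hsub)
  have hws := ContDiffMapSupportedIn.withSeminorms ℝ V ℝ (⊤ : ℕ∞) K'
  let q : Seminorm ℝ 𝓓_{K'}(V, ℝ) := (normSeminorm ℝ 𝕜).comp L
  have hq : Continuous q := continuous_norm.comp hL
  obtain ⟨s, C, -, hC⟩ := Seminorm.bound_of_continuous hws q hq
  -- The order is the largest index among the finitely many seminorms.
  refine ⟨s.sup id, C, C.2, fun φ B hφ hB => ?_⟩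
  let φ' : 𝓓_{K'}(V, ℝ) := ⟨φ, φ.contDiff, fun x hx => hφ x hx⟩
  have h0 : 0 ≤ B := (norm_nonneg _).trans (hB 0 (Nat.zero_le _) 0)
  have h1 : (s.sup fun i => ContDiffMapSupportedIn.seminorm ℝ V ℝ (⊤ : ℕ∞) K' i) φ' ≤ B := by
    refine Seminorm.finset_sup_apply_le h0 fun i hi => ?_
    rw [ContDiffMapSupportedIn.seminorm_top_le_iff ℝ h0]
    intro x _
    exact hB i (Finset.le_sup (f := id) hi) x
  exact (hC φ').trans (mul_le_mul_of_nonneg_left h1 C.2)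

/-- A linear functional with order bounds on each compact set is a distribution. -/
theorem DistOver.exists_of_bound (T : Test V → 𝕜) (hadd : ∀ φ ψ, T (φ + ψ) = T φ + T ψ)
    (hsmul : ∀ (a : ℝ) φ, T (a • φ) = a • T φ)
    (hT : ∀ K : Set V, IsCompact K → ∃ (N : ℕ) (C : ℝ), 0 ≤ C ∧ ∀ (φ : Test V) (B : ℝ),
      (∀ x ∉ K, φ x = 0) →
      (∀ i ≤ N, ∀ x, ‖iteratedFDeriv ℝ i φ x‖ ≤ B) → ‖T φ‖ ≤ C * B) :
    ∃ h : DistOver V 𝕜, ∀ φ, h φ = T φ := by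
  refine ⟨TestFunction.mkCLM ℝ T hadd hsmul fun K hK => ?_, fun φ => rfl⟩
  obtain ⟨N, C, hC, h⟩ := hT K K.isCompact
  refine (ContDiffMapSupportedIn.mkCLMtoNormedSpace (𝕜 := ℝ)
    (fun φ : 𝓓_{K}(V, ℝ) => T (TestFunction.ofSupportedIn hK φ))
    (fun φ ψ => hadd (TestFunction.ofSupportedIn hK φ) (TestFunction.ofSupportedIn hK ψ))
    (fun a φ => hsmul a (TestFunction.ofSupportedIn hK φ))
    ⟨Finset.range (N + 1), C, hC, fun φ => ?_⟩).continuous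
  refine h _ _ (fun x hx => φ.zero_on_compl hx) fun i hi x => ?_
  refine (ContDiffMapSupportedIn.norm_iteratedFDeriv_apply_le_seminorm_top ℝ
    (f := φ) (i := i) (x := x)).trans ?_
  exact Seminorm.le_finset_sup_apply (p := fun j =>
    ContDiffMapSupportedIn.seminorm ℝ V ℝ (⊤ : ℕ∞) K j) (Finset.mem_range.2 (by omega))

end Bounds

/-! ### Pairing a distribution with the translates of a test function -/

section Translates

variable {𝕜 : Type*} [RCLike 𝕜] {V : Type*} [NormedAddCommGroup V] [NormedSpace ℝ V]

theorem isCompact_sub_tsupport {L : Set V} (hL : IsCompact L) (φ : Test V) :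
    ∃ K : Set V, IsCompact K ∧ ∀ x ∈ L, ∀ y ∉ K, φ (x + y) = 0 := by
  refine ⟨(fun p : V × V => p.1 - p.2) '' (tsupport φ ×ˢ L),
    (φ.hasCompactSupport.isCompact.prod hL).image (by fun_prop), fun x hx y hy => ?_⟩
  by_contra hne
  exact hy ⟨(x + y, x), ⟨subset_tsupport _ hne, hx⟩, by simp⟩

/-- The first-order remainder in $s$ is $o(s-t)$ uniformly in all derivatives up to order `N`, by
the mean value inequality and the uniform continuity of the derivatives of $\partial_c\varphi$. For
$s$ near $t$ the remainders vanish off one compact set, so the order bound of `g` applies. -/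
theorem DistOver.hasDerivAt_translate (g : DistOver V 𝕜) (φ : Test V) (x c : V) (t : ℝ) :
    HasDerivAt (fun s : ℝ => g (translateTest (x + s • c) φ))
      (g (translateTest (x + t • c) (∂_{c} φ))) t := by
  have hLc : IsCompact ((fun s : ℝ => x + s • c) '' Metric.closedBall t 1) :=
    (isCompact_closedBall t 1).image (by fun_prop)
  obtain ⟨K₁, hK₁, hKφ⟩ := isCompact_sub_tsupport hLc φ
  obtain ⟨K₂, hK₂, hKψ⟩ := isCompact_sub_tsupport hLc (∂_{c} φ : Test V)
  obtain ⟨N, C, hC, hg⟩ := g.exists_bound (hK₁.union hK₂)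
  rw [hasDerivAt_iff_isLittleO, Asymptotics.isLittleO_iff]
  intro ε hε
  obtain ⟨δ, hδ, h⟩ := eventually_norm_iteratedFDeriv_translate_sub_le (∂_{c} φ : Test V) N
    (ε := ε / (C + 1)) (by positivity)
  -- The bound `1` keeps the translations in the compact segment; the denominator `‖c‖ + 1` makes
  -- them differ by less than `δ`, also for `c = 0`.
  have hδ' : 0 < min (δ / (‖c‖ + 1)) 1 := by positivity
  filter_upwards [Metric.ball_mem_nhds t hδ'] with s hs
  rw [Metric.mem_ball, dist_eq_norm] at hs
  rw [← map_sub, ← map_smul, ← map_sub]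
  have hmem : ∀ s', ‖s' - t‖ < min (δ / (‖c‖ + 1)) 1 →
      x + s' • c ∈ (fun s : ℝ => x + s • c) '' Metric.closedBall t 1 := fun s' hs' =>
    ⟨s', by simpa [dist_eq_norm] using (hs'.trans_le (min_le_right _ _)).le, rfl⟩
  have ht : ‖t - t‖ < min (δ / (‖c‖ + 1)) 1 := by simpa using hδ'
  have h1 : ‖g (translateTest (x + s • c) φ - translateTest (x + t • c) φ
      - (s - t) • translateTest (x + t • c) (∂_{c} φ))‖ ≤ C * (ε / (C + 1) * ‖s - t‖) := by
    refine hg _ _ (fun y hy => ?_) fun i hi y => ?_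
    · rw [Set.mem_union, not_or] at hy
      change φ (x + s • c + y) - φ (x + t • c + y)
        - (s - t) • (∂_{c} φ : Test V) (x + t • c + y) = 0
      rw [hKφ _ (hmem s hs) y hy.1, hKφ _ (hmem t ht) y hy.1, hKψ _ (hmem t ht) y hy.2]
      simp
    · have hcd : ∀ ψ : Test V, ContDiffAt ℝ i ψ y := fun ψ =>
        (test_contDiff ψ).contDiffAt.of_le (by exact_mod_cast le_top)
      have e1 : iteratedFDeriv ℝ i (translateTest (x + s • c) φ - translateTest (x + t • c) φ
          - (s - t) • translateTest (x + t • c) (∂_{c} φ) : Test V) y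
          = iteratedFDeriv ℝ i φ (s • c + (x + y)) - iteratedFDeriv ℝ i φ (t • c + (x + y))
          - (s - t) • iteratedFDeriv ℝ i (∂_{c} φ : Test V) (t • c + (x + y)) := by
        have a1 := iteratedFDeriv_sub_apply (hcd (translateTest (x + s • c) φ
          - translateTest (x + t • c) φ)) (hcd ((s - t) • translateTest (x + t • c) (∂_{c} φ)))
        have a2 := iteratedFDeriv_sub_apply (hcd (translateTest (x + s • c) φ))
          (hcd (translateTest (x + t • c) φ))
        have a3 := iteratedFDeriv_const_smul_apply (a := s - t)
          (hcd (translateTest (x + t • c) (∂_{c} φ)))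
        have b : ∀ s : ℝ, x + s • c + y = s • c + (x + y) := fun s => by abel
        rw [← b, ← b, ← iteratedFDeriv_translateTest, ← iteratedFDeriv_translateTest,
          ← iteratedFDeriv_translateTest, ← a3, ← a2]
        exact a1
      rw [e1]
      have key := (convex_ball t (min (δ / (‖c‖ + 1)) 1)).norm_image_sub_le_of_norm_hasDerivWithin_le
        (f := fun s : ℝ => iteratedFDeriv ℝ i φ (s • c + (x + y))
          - (s - t) • iteratedFDeriv ℝ i (∂_{c} φ : Test V) (t • c + (x + y)))
        (f' := fun s : ℝ => iteratedFDeriv ℝ i (∂_{c} φ : Test V) (s • c + (x + y))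
          - (1 : ℝ) • iteratedFDeriv ℝ i (∂_{c} φ : Test V) (t • c + (x + y)))
        (C := ε / (C + 1)) (x := t) (y := s)
        (fun s' _ => ((hasDerivAt_iteratedFDeriv_test φ i (x + y) c s').sub
          (((hasDerivAt_id s').sub_const t).smul_const _)).hasDerivWithinAt)
        (fun s' hs' => ?_) (Metric.mem_ball_self hδ') (by simpa [dist_eq_norm] using hs)
      · simpa [sub_right_comm] using key
      · rw [one_smul]
        refine h _ _ ?_ i hi (x + y)
        rw [Metric.mem_ball, dist_eq_norm] at hs'
        rw [← sub_smul, norm_smul]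
        have := hs'.trans_le (min_le_left _ _)
        rw [lt_div_iff₀ (by positivity)] at this
        nlinarith [norm_nonneg (s' - t), norm_nonneg c]
  refine h1.trans ?_
  rw [← mul_assoc]
  refine mul_le_mul_of_nonneg_right ?_ (norm_nonneg _)
  rw [mul_div_assoc', div_le_iff₀ (by positivity)]
  nlinarith

variable [FiniteDimensional ℝ V]

theorem DistOver.continuous_translate (g : DistOver V 𝕜) (φ : Test V) :
    Continuous fun x => g (translateTest x φ) := by
  rw [Metric.continuous_iff]
  intro x₀ ε hε
  have : ProperSpace V := FiniteDimensional.proper ℝ V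
  obtain ⟨K, hK, hKφ⟩ := isCompact_sub_tsupport (isCompact_closedBall x₀ 1) φ
  obtain ⟨N, C, hC, hg⟩ := g.exists_bound hK
  obtain ⟨δ, hδ, h⟩ := eventually_norm_iteratedFDeriv_translate_sub_le φ N
    (ε := ε / (2 * (C + 1))) (by positivity)
  refine ⟨min δ 1, by positivity, fun x hx => ?_⟩
  rw [dist_eq_norm] at hx
  rw [dist_eq_norm, ← map_sub]
  have h1 : ‖g (translateTest x φ - translateTest x₀ φ)‖ ≤ C * (ε / (2 * (C + 1))) := by
    refine hg _ _ (fun y hy => ?_) fun i hi y => ?_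
    · change φ (x + y) - φ (x₀ + y) = 0
      rw [hKφ x (by simpa [dist_eq_norm] using (hx.trans_le (min_le_right _ _)).le) y hy,
        hKφ x₀ (by simp) y hy, sub_zero]
    · have : iteratedFDeriv ℝ i (translateTest x φ - translateTest x₀ φ : Test V) y
          = iteratedFDeriv ℝ i φ (x + y) - iteratedFDeriv ℝ i φ (x₀ + y) := by
        rw [← iteratedFDeriv_translateTest, ← iteratedFDeriv_translateTest]
        exact iteratedFDeriv_sub_apply
          ((test_contDiff _).contDiffAt.of_le (by exact_mod_cast le_top))
          ((test_contDiff _).contDiffAt.of_le (by exact_mod_cast le_top))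
      rw [this]
      exact h x x₀ (hx.trans_le (min_le_left _ _)) i hi y
  refine h1.trans_lt ?_
  rw [mul_div_assoc', div_lt_iff₀ (by positivity)]
  nlinarith

end Translates

/-! ### The spline as a measure on a cone -/

section SplineMeasure

variable {V : Type*} [NormedAddCommGroup V] [NormedSpace ℝ V] [FiniteDimensional ℝ V]
  [MeasurableSpace V] [BorelSpace V] {ι : Type*}

omit [FiniteDimensional ℝ V] [MeasurableSpace V] [BorelSpace V] in
theorem continuous_coneMap (S : Finset ι) (c : ι → V) :
    Continuous fun t : S → ℝ => ∑ i : S, t i • c i := by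
  fun_prop

omit [FiniteDimensional ℝ V] in
theorem measurable_coneMap (S : Finset ι) (c : ι → V) :
    Measurable fun t : S → ℝ => ∑ i : S, t i • c i :=
  (continuous_coneMap S c).measurable

omit [FiniteDimensional ℝ V] [BorelSpace V] in
theorem splineMeasure_eq_map_pi (S : Finset ι) (c : ι → V) :
    splineMeasure S c = (Measure.pi fun _ : S => (volume : Measure ℝ).restrict (Set.Ici 0)).map
      fun t => ∑ i : S, t i • c i := by
  rw [splineMeasure, ← Measure.restrict_pi_pi]
  congr 2
  ext t
  simp [Pi.le_def]

omit [FiniteDimensional ℝ V] in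
theorem splineMeasure_singleton (i : ι) (c : ι → V) :
    splineMeasure {i} c
      = ((volume : Measure ℝ).restrict (Set.Ici 0)).map fun t : ℝ => t • c i := by
  classical
  let _ : Unique ({i} : Finset ι) :=
    ⟨⟨⟨i, by simp⟩⟩, fun j => Subtype.ext (Finset.mem_singleton.1 j.2)⟩
  have e := measurePreserving_funUnique
    ((volume : Measure ℝ).restrict (Set.Ici 0)) ({i} : Finset ι)
  conv_rhs => rw [← e.map_eq]
  rw [splineMeasure_eq_map_pi, Measure.map_map (by fun_prop) e.measurable]
  congr 1
  ext t
  rw [Fintype.sum_unique]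
  rfl

omit [FiniteDimensional ℝ V] in
theorem splineMeasure_empty (c : ι → V) : splineMeasure ∅ c = Measure.dirac 0 := by
  rw [splineMeasure_eq_map_pi, Measure.pi_of_empty _ (fun j => (Finset.notMem_empty _ j.2).elim)]
  refine (Measure.map_dirac' (measurable_coneMap _ _) _).trans ?_
  simp

/-- The orthant of a disjoint union is a product of orthants. This allows one generator to be split
off and integrated separately. -/
theorem splineMeasure_union [DecidableEq ι] {S T : Finset ι} (h : Disjoint S T) (c : ι → V) :
    splineMeasure (S ∪ T) c
      = ((splineMeasure S c).prod (splineMeasure T c)).map fun p => p.1 + p.2 := by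
  have e := (measurePreserving_piFinsetUnion h
    (fun _ : ι => (volume : Measure ℝ).restrict (Set.Ici 0)))
  rw [splineMeasure_eq_map_pi, splineMeasure_eq_map_pi, splineMeasure_eq_map_pi,
    Measure.map_prod_map _ _ (measurable_coneMap _ _) (measurable_coneMap _ _), ← e.map_eq,
    Measure.map_map (measurable_coneMap _ _) e.measurable,
    Measure.map_map (by fun_prop) ((measurable_coneMap _ _).prodMap (measurable_coneMap _ _))]
  congr 1
  ext ⟨s, t⟩
  simp only [Function.comp_apply, Prod.map_apply]
  rw [← (Equiv.Finset.union S T h).sum_comp, Fintype.sum_sum_type]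
  congr 1
  · refine Finset.sum_congr rfl fun j _ => ?_
    rw [Equiv.Finset.union_inl]
    congr 1
    exact Equiv.piFinsetUnion_left (fun _ => ℝ) h j.2 _
  · refine Finset.sum_congr rfl fun j _ => ?_
    rw [Equiv.Finset.union_inr]
    congr 1
    exact Equiv.piFinsetUnion_right (fun _ => ℝ) h j.2 _

omit [FiniteDimensional ℝ V] in
/-- The spline measure is carried by the cone spanned by its vectors. -/
theorem ae_splineMeasure_mem_cone (S : Finset ι) (c : ι → V) :
    ∀ᵐ x ∂splineMeasure S c, ∃ t : S → ℝ, 0 ≤ t ∧ x = ∑ i : S, t i • c i := by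
  -- Measurability of the cone: it is a countable union of compact images of cubes.
  have hC : {x | ∃ t : S → ℝ, 0 ≤ t ∧ x = ∑ i : S, t i • c i}
      = ⋃ n : ℕ, (fun t : S → ℝ => ∑ i : S, t i • c i) '' Set.Icc 0 (fun _ => (n : ℝ)) := by
    ext x
    simp only [Set.mem_ofPred_eq, Set.mem_iUnion, Set.mem_image, Set.mem_Icc]
    constructor
    · rintro ⟨t, ht, rfl⟩
      obtain ⟨n, hn⟩ := exists_nat_ge (∑ i, t i)
      refine ⟨n, t, ⟨ht, fun i => ?_⟩, rfl⟩
      exact (Finset.single_le_sum (f := t) (fun i _ => ht i) (Finset.mem_univ i)).trans hn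
    · rintro ⟨n, t, ht, rfl⟩
      exact ⟨t, ht.1, rfl⟩
  have hm : MeasurableSet {x | ∃ t : S → ℝ, 0 ≤ t ∧ x = ∑ i : S, t i • c i} := by
    rw [hC]
    exact MeasurableSet.iUnion fun n =>
      (isCompact_Icc.image (continuous_coneMap S c)).isClosed.measurableSet
  rw [splineMeasure, ae_map_iff (measurable_coneMap S c).aemeasurable hm]
  filter_upwards [ae_restrict_mem measurableSet_Ici] with t ht
  exact ⟨t, ht, rfl⟩

section Positive

variable {S : Finset ι} {c : ι → V} {u : Module.Dual ℝ V}

-- Each term $t_iu(c_i)$ is nonnegative and hence at most the whole sum. This compactness of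
-- truncated cones makes the spline locally finite and later makes the face cones closed.
omit [FiniteDimensional ℝ V] [MeasurableSpace V] [BorelSpace V] in
theorem coneMap_mem_box (hu : ∀ i ∈ S, 0 < u (c i)) {t : S → ℝ} (ht : 0 ≤ t) {M : ℝ}
    (hM : u (∑ i : S, t i • c i) ≤ M) : t ∈ Set.Icc 0 (fun i : S => M / u (c i)) := by
  refine ⟨ht, fun i => ?_⟩
  rw [le_div_iff₀ (hu i i.2)]
  rw [map_sum] at hM
  simp only [map_smul, smul_eq_mul] at hM
  exact (Finset.single_le_sum (f := fun i : S => t i * u (c i))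
    (fun j _ => mul_nonneg (ht j) (hu j j.2).le) (Finset.mem_univ i)).trans hM

theorem splineMeasure_setOf_le_lt_top (hu : ∀ i ∈ S, 0 < u (c i)) (M : ℝ) :
    splineMeasure S c {x | u x ≤ M} < ⊤ := by
  have hcu : Continuous u := LinearMap.continuous_of_finiteDimensional u
  have hm : MeasurableSet {x | u x ≤ M} := (isClosed_le hcu continuous_const).measurableSet
  rw [splineMeasure, Measure.map_apply (measurable_coneMap S c) hm,
    Measure.restrict_apply ((measurable_coneMap S c) hm)]
  refine (measure_mono (t := Set.Icc 0 (fun i : S => M / u (c i))) ?_).trans_lt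
    isCompact_Icc.measure_lt_top
  rintro t ⟨h1, h2⟩
  exact coneMap_mem_box hu h2 h1

omit [FiniteDimensional ℝ V] in
theorem exists_isCompact_ae_splineMeasure (hu : ∀ i ∈ S, 0 < u (c i)) (M : ℝ) :
    ∃ L : Set V, IsCompact L ∧ ∀ᵐ x ∂splineMeasure S c, u x ≤ M → x ∈ L := by
  refine ⟨_, isCompact_Icc.image (continuous_coneMap S c) (s := Set.Icc 0
    (fun i : S => M / u (c i))), ?_⟩
  filter_upwards [ae_splineMeasure_mem_cone S c]
  rintro x ⟨t, ht, rfl⟩ hM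
  exact ⟨t, coneMap_mem_box hu ht hM, rfl⟩

theorem isFiniteMeasureOnCompacts_splineMeasure (hu : ∀ i ∈ S, 0 < u (c i)) :
    IsFiniteMeasureOnCompacts (splineMeasure S c) where
  lt_top_of_isCompact K hK := by
    have hcu : Continuous u := LinearMap.continuous_of_finiteDimensional u
    obtain ⟨M, hM⟩ := hK.bddAbove_image hcu.continuousOn
    exact (measure_mono fun x hx => hM ⟨x, hx, rfl⟩).trans_lt
      (splineMeasure_setOf_le_lt_top hu M)

theorem integrable_splineMeasure {E : Type*} [NormedAddCommGroup E]
    (hu : ∀ i ∈ S, 0 < u (c i)) {F : V → E} (hF : Continuous F) {M : ℝ}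
    (hM : ∀ x, F x ≠ 0 → u x ≤ M) : Integrable F (splineMeasure S c) := by
  have := isFiniteMeasureOnCompacts_splineMeasure hu
  have : ProperSpace V := FiniteDimensional.proper ℝ V
  obtain ⟨L, hL, hae⟩ := exists_isCompact_ae_splineMeasure hu M
  have h1 : IntegrableOn F L (splineMeasure S c) := hF.continuousOn.integrableOn_compact hL
  rw [← integrable_indicator_iff hL.isClosed.measurableSet] at h1
  refine h1.congr ?_
  filter_upwards [hae] with x hx
  by_cases h : x ∈ L
  · rw [Set.indicator_of_mem h]
  · rw [Set.indicator_of_notMem h]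
    by_contra hne
    exact h (hx (hM x (Ne.symm hne)))

/-- Fubini, then the fundamental theorem of calculus on each ray $x+\mathbb R_{\ge0}c_i$: `u` grows
along the ray, so `H` vanishes far out and only the boundary term $-H(x)$ is left. -/
theorem integral_splineMeasure_insert_of_hasDerivAt {𝕜 : Type*} [RCLike 𝕜] [DecidableEq ι]
    {i : ι} (hi : i ∉ S)
    (hu : ∀ j ∈ insert i S, 0 < u (c j)) {F H : V → 𝕜} (hF : Continuous F) {M : ℝ}
    (hFM : ∀ x, F x ≠ 0 → u x ≤ M) (hHM : ∀ x, H x ≠ 0 → u x ≤ M)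
    (hd : ∀ x (t : ℝ), HasDerivAt (fun s : ℝ => H (x + s • c i)) (F (x + t • c i)) t) :
    ∫ x, F x ∂splineMeasure (insert i S) c = - ∫ x, H x ∂splineMeasure S c := by
  have hui : 0 < u (c i) := hu i (Finset.mem_insert_self _ _)
  have hdis : Disjoint S {i} := by simpa using hi
  have hins : insert i S = S ∪ {i} := by
    rw [Finset.union_comm, Finset.insert_eq]
  have hint := integrable_splineMeasure hu hF hFM
  rw [hins, splineMeasure_union hdis, splineMeasure_singleton] at hint ⊢
  have hfin := isFiniteMeasureOnCompacts_splineMeasure (S := S) (c := c) (u := u)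
    (fun j hj => hu j (Finset.mem_insert_of_mem hj))
  have : ProperSpace V := FiniteDimensional.proper ℝ V
  have hm : Measurable fun p : V × V => p.1 + p.2 := by fun_prop
  rw [integral_map hm.aemeasurable hF.aestronglyMeasurable]
  rw [integrable_map_measure hF.aestronglyMeasurable hm.aemeasurable] at hint
  have : SFinite (Measure.map (fun t : ℝ => t • c i) (volume.restrict (Set.Ici 0))) :=
    inferInstance
  refine (integral_prod _ hint).trans ?_
  rw [← integral_neg]
  simp only [Function.comp_apply]
  congr 1
  ext x
  have hmi : Measurable fun t : ℝ => t • c i := by fun_prop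
  rw [integral_map (φ := fun t : ℝ => t • c i) hmi.aemeasurable
    (by fun_prop : Continuous fun y => F (x + y)).aestronglyMeasurable]
  -- Beyond `b`, the value of `u` on the ray exceeds `M`, so `F` and `H` vanish there.
  set b : ℝ := max 0 ((M - u x) / u (c i)) + 1 with hb
  have hzero : ∀ s : ℝ, b ≤ s → ¬ u (x + s • c i) ≤ M := by
    intro s hs h
    rw [map_add, map_smul, smul_eq_mul] at h
    have h1 : s ≤ (M - u x) / u (c i) := by
      rw [le_div_iff₀ hui]
      linarith
    have h2 := le_max_right 0 ((M - u x) / u (c i))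
    linarith
  have hb0 : 0 ≤ b := by positivity
  rw [integral_Ici_eq_integral_Ioi,
    setIntegral_eq_of_subset_of_forall_sdiff_eq_zero measurableSet_Ioi
      (show Set.Ioc 0 b ⊆ Set.Ioi 0 from fun _ h => h.1),
    ← intervalIntegral.integral_of_le hb0,
    intervalIntegral.integral_eq_sub_of_hasDerivAt (fun t _ => hd x t)
      (Continuous.intervalIntegrable (by fun_prop) _ _)]
  · have h1 : H (x + b • c i) = 0 := by
      by_contra h
      exact hzero b le_rfl (hHM _ h)
    rw [h1]
    simp
  · intro s hs
    by_contra h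
    refine hzero s ?_ (hFM _ h)
    by_contra hlt
    exact hs.2 ⟨hs.1, (not_le.1 hlt).le⟩

end Positive

end SplineMeasure

/-! ### Convolution of a spline with a distribution on a subspace -/

section Convolution

variable {𝕜 : Type*} [RCLike 𝕜] {V : Type*} [NormedAddCommGroup V] [NormedSpace ℝ V]
  {ι : Type*} {r : Submodule ℝ V} {u : Module.Dual ℝ V} {g : DistOver V 𝕜}

/-- The pairing of a distribution on `r` with a translate vanishes unless the translate meets
`r`. -/
theorem le_of_distOn_translate_ne_zero (hr : u ∈ r.dualAnnihilator) (hg : g ∈ distOn 𝕜 r)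
    {φ : Test V} {K : Set V} (hφ : ∀ x ∉ K, φ x = 0) {M : ℝ} (hK : ∀ x ∈ K, u x ≤ M) (x : V)
    (hx : g (translateTest x φ) ≠ 0) : u x ≤ M := by
  by_contra hM
  refine hx (hg _ fun y hy => hφ _ fun hmem => hM ?_)
  have h1 := hK _ hmem
  rw [map_add, (Submodule.mem_dualAnnihilator u).1 hr y hy, add_zero] at h1
  exact h1

theorem exists_forall_test_le [FiniteDimensional ℝ V] (u : Module.Dual ℝ V) {K : Set V}
    (hK : IsCompact K) : ∃ M, ∀ x ∈ K, u x ≤ M := by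
  obtain ⟨M, hM⟩ := hK.bddAbove_image
    (LinearMap.continuous_of_finiteDimensional u).continuousOn
  exact ⟨M, fun x hx => hM ⟨x, hx, rfl⟩⟩

variable [FiniteDimensional ℝ V] [MeasurableSpace V] [BorelSpace V] {S : Finset ι} {c : ι → V}

theorem integrable_translate_splineMeasure (hr : u ∈ r.dualAnnihilator)
    (hu : ∀ i ∈ S, 0 < u (c i)) (hg : g ∈ distOn 𝕜 r) (φ : Test V) :
    Integrable (fun x => g (translateTest x φ)) (splineMeasure S c) := by
  obtain ⟨M, hM⟩ := exists_forall_test_le u φ.hasCompactSupport.isCompact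
  exact integrable_splineMeasure hu (g.continuous_translate φ)
    (le_of_distOn_translate_ne_zero hr hg (fun x hx => image_eq_zero_of_notMem_tsupport hx) hM)

/-- For test functions supported in `K`, the integrand vanishes where `u x > M`. Elsewhere `x` lies
almost surely in a compact `L`, so the translates have support in $K-L$ and one order bound of `g`
serves them all, over a set of finite spline measure. -/
theorem exists_dist_eq_integral_splineMeasure (hr : u ∈ r.dualAnnihilator)
    (hu : ∀ i ∈ S, 0 < u (c i)) (hg : g ∈ distOn 𝕜 r) :
    ∃ h : DistOver V 𝕜, ∀ φ, h φ = ∫ x, g (translateTest x φ) ∂splineMeasure S c := by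
  have hint := integrable_translate_splineMeasure (c := c) hr hu hg
  refine DistOver.exists_of_bound _ (fun φ ψ => ?_) (fun a φ => ?_) fun K hK => ?_
  · rw [← integral_add (hint φ) (hint ψ)]
    simp only [translateTest_add, map_add]
  · rw [← integral_smul]
    simp only [translateTest_smul, map_smul]
  · obtain ⟨M, hM⟩ := exists_forall_test_le u hK
    obtain ⟨L, hL, hae⟩ := exists_isCompact_ae_splineMeasure (c := c) hu M
    have hK' : IsCompact ((fun p : V × V => p.1 - p.2) '' (K ×ˢ L)) :=
      (hK.prod hL).image (by fun_prop)
    obtain ⟨N, C, hC, hb⟩ := g.exists_bound hK'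
    refine ⟨N, C * (splineMeasure S c).real {x | u x ≤ M}, by positivity, ?_⟩
    intro φ B hφ hB
    have hB0 : 0 ≤ B := (norm_nonneg _).trans (hB 0 (Nat.zero_le _) 0)
    have hms : MeasurableSet {x | u x ≤ M} :=
      (isClosed_le (LinearMap.continuous_of_finiteDimensional u)
        continuous_const).measurableSet
    have hlt := splineMeasure_setOf_le_lt_top (c := c) hu M
    have hbound : ∀ᵐ x ∂splineMeasure S c, ‖g (translateTest x φ)‖
        ≤ Set.indicator {x | u x ≤ M} (fun _ => C * B) x := by
      filter_upwards [hae] with x hx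
      by_cases h : g (translateTest x φ) = 0
      · rw [h, norm_zero]
        exact Set.indicator_nonneg (fun _ _ => mul_nonneg hC hB0) x
      · have hux := le_of_distOn_translate_ne_zero hr hg hφ hM x h
        rw [Set.indicator_of_mem (by exact hux)]
        refine hb _ _ (fun y hy => hφ _ fun hmem => hy ⟨(x + y, x), ⟨hmem, hx hux⟩, by simp⟩) ?_
        intro i hi y
        rw [iteratedFDeriv_translateTest]
        exact hB i hi _
    refine (norm_integral_le_of_norm_le ?_ hbound).trans ?_
    · exact (integrable_indicator_iff hms).2 (integrableOn_const hlt.ne)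
    · rw [integral_indicator hms, setIntegral_const, smul_eq_mul]
      exact le_of_eq (by ring)

/-- Differentiating along `c i` removes `c i` from the spline. -/
theorem integral_splineMeasure_insert_translate_lineDeriv [DecidableEq ι] {i : ι} (hi : i ∉ S)
    (hr : u ∈ r.dualAnnihilator) (hu : ∀ j ∈ insert i S, 0 < u (c j)) (hg : g ∈ distOn 𝕜 r)
    (φ : Test V) :
    ∫ x, g (translateTest x (∂_{c i} φ)) ∂splineMeasure (insert i S) c
      = - ∫ x, g (translateTest x φ) ∂splineMeasure S c := by
  obtain ⟨M₁, hM₁⟩ := exists_forall_test_le u φ.hasCompactSupport.isCompact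
  obtain ⟨M₂, hM₂⟩ := exists_forall_test_le u (∂_{c i} φ : Test V).hasCompactSupport.isCompact
  refine integral_splineMeasure_insert_of_hasDerivAt hi hu (g.continuous_translate _)
    (M := max M₁ M₂) (fun x hx => ?_) (fun x hx => ?_) fun x t => g.hasDerivAt_translate φ x _ t
  · exact (le_of_distOn_translate_ne_zero hr hg
      (fun x hx => image_eq_zero_of_notMem_tsupport hx) hM₂ x hx).trans (le_max_right _ _)
  · exact (le_of_distOn_translate_ne_zero hr hg
      (fun x hx => image_eq_zero_of_notMem_tsupport hx) hM₁ x hx).trans (le_max_left _ _)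

end Convolution

/-! ### Exchanging a distribution with an average of translates -/

section Regularization

variable {𝕜 : Type*} [RCLike 𝕜] {V : Type*} [NormedAddCommGroup V] [NormedSpace ℝ V]
  [FiniteDimensional ℝ V] [MeasurableSpace V] [BorelSpace V] (μ : Measure V)

theorem integrable_test_smul [IsFiniteMeasureOnCompacts μ] {E : Type*} [NormedAddCommGroup E]
    [NormedSpace ℝ E] (ψ : Test V) {A : V → E} (hA : Continuous A) :
    Integrable (fun x => ψ x • A x) μ := by
  have : ProperSpace V := FiniteDimensional.proper ℝ V
  exact (ψ.continuous.smul hA).integrable_of_hasCompactSupport ψ.hasCompactSupport.smul_right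

theorem hasFDerivAt_integral_test_smul [IsFiniteMeasureOnCompacts μ] {E : Type*}
    [NormedAddCommGroup E] [NormedSpace ℝ E] (ψ : Test V) {A : V → E}
    (hA : ContDiff ℝ 1 A) {B : ℝ} (hB : ∀ x, ‖fderiv ℝ A x‖ ≤ B) (y : V) :
    HasFDerivAt (fun y => ∫ x, ψ x • A (x + y) ∂μ) (∫ x, ψ x • fderiv ℝ A (x + y) ∂μ) y := by
  have hA0 := hA.continuous
  have hA1 : Continuous (fderiv ℝ A) := hA.continuous_fderiv (by simp)
  have : ProperSpace V := FiniteDimensional.proper ℝ V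
  refine hasFDerivAt_integral_of_dominated_of_fderiv_le (bound := fun x => ‖ψ x‖ * B)
    (F' := fun y x => ψ x • fderiv ℝ A (x + y)) Filter.univ_mem
    (Eventually.of_forall fun z => ?_) ?_ ?_ (Eventually.of_forall fun x z _ => ?_) ?_
    (Eventually.of_forall fun x z _ => ?_)
  · exact (integrable_test_smul μ ψ (by fun_prop)).aestronglyMeasurable
  · exact integrable_test_smul μ ψ (by fun_prop)
  · exact (integrable_test_smul μ ψ (A := fun x => fderiv ℝ A (x + y))
      (by fun_prop)).aestronglyMeasurable
  · rw [norm_smul]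
    exact mul_le_mul_of_nonneg_left (hB _) (norm_nonneg _)
  · simpa using (integrable_test_smul μ ψ (A := fun _ => (1 : ℝ))
      continuous_const).norm.mul_const B
  · have h := ((hA.differentiable (by simp)) (x + z)).hasFDerivAt
    have h2 := h.comp z ((hasFDerivAt_id z).const_add x)
    exact (h2.const_smul (ψ x))

theorem fderiv_integral_test_smul_apply [IsFiniteMeasureOnCompacts μ] {E : Type*}
    [NormedAddCommGroup E] [NormedSpace ℝ E] (ψ : Test V) {A : V → E}
    (hA : ContDiff ℝ 1 A) {B : ℝ} (hB : ∀ x, ‖fderiv ℝ A x‖ ≤ B) (y v : V) :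
    fderiv ℝ (fun y => ∫ x, ψ x • A (x + y) ∂μ) y v = ∫ x, ψ x • fderiv ℝ A (x + y) v ∂μ := by
  have hint : Integrable (fun x => ψ x • fderiv ℝ A (x + y)) μ :=
    integrable_test_smul μ ψ
      ((hA.continuous_fderiv (by simp)).comp (continuous_id.add continuous_const))
  rw [(hasFDerivAt_integral_test_smul μ ψ hA hB y).fderiv,
    ContinuousLinearMap.integral_apply hint]
  rfl

theorem iteratedFDeriv_integral_translate [IsFiniteMeasureOnCompacts μ] (φ ψ : Test V)
    (i : ℕ) :
    iteratedFDeriv ℝ i (fun y => ∫ x, ψ x • φ (x + y) ∂μ)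
      = fun y => ∫ x, ψ x • iteratedFDeriv ℝ i φ (x + y) ∂μ := by
  have hc : ∀ i y, Integrable (fun x => ψ x • iteratedFDeriv ℝ i φ (x + y)) μ := fun i y =>
    integrable_test_smul μ ψ ((test_continuous_iteratedFDeriv φ i).comp (by fun_prop))
  induction i with
  | zero =>
    ext y m
    rw [ContinuousMultilinearMap.integral_apply (hc 0 y)]
    simp
  | succ i ih =>
    ext y m
    have hA : ContDiff ℝ 1 (iteratedFDeriv ℝ i φ) :=
      (test_contDiff φ).iteratedFDeriv_right (by exact_mod_cast le_top)
    obtain ⟨B, -, hB⟩ := test_exists_bound φ (i + 1)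
    have hB' : ∀ x, ‖fderiv ℝ (iteratedFDeriv ℝ i φ) x‖ ≤ B := fun x => by
      rw [norm_fderiv_iteratedFDeriv]
      exact hB _ le_rfl x
    have hint : Integrable (fun x => ψ x • fderiv ℝ (iteratedFDeriv ℝ i φ) (x + y) (m 0)) μ :=
      integrable_test_smul μ ψ (((hA.continuous_fderiv (by simp)).comp
        (continuous_id.add continuous_const)).clm_apply continuous_const)
    rw [iteratedFDeriv_succ_apply_left, ih, fderiv_integral_test_smul_apply μ ψ hA hB',
      ContinuousMultilinearMap.integral_apply (hc (i + 1) y),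
      ContinuousMultilinearMap.integral_apply hint]
    rfl

/-- The space of values of the `i`-th derivative of a test function. -/
def JetComponent (V : Type*) [NormedAddCommGroup V] [NormedSpace ℝ V] (i : ℕ) : Type _ :=
  V [×i]→L[ℝ] ℝ

noncomputable instance (V : Type*) [NormedAddCommGroup V] [NormedSpace ℝ V] (i : ℕ) :
    NormedAddCommGroup (JetComponent V i) :=
  inferInstanceAs (NormedAddCommGroup (V [×i]→L[ℝ] ℝ))

noncomputable instance (V : Type*) [NormedAddCommGroup V] [NormedSpace ℝ V] (i : ℕ) :
    NormedSpace ℝ (JetComponent V i) :=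
  inferInstanceAs (NormedSpace ℝ (V [×i]→L[ℝ] ℝ))

instance (V : Type*) [NormedAddCommGroup V] [NormedSpace ℝ V] (i : ℕ) :
    CompleteSpace (JetComponent V i) :=
  inferInstanceAs (CompleteSpace (V [×i]→L[ℝ] ℝ))

/-- The `i`-th derivative of a test function. -/
noncomputable def jetComponent (i : ℕ) (φ : Test V) : V → JetComponent V i :=
  iteratedFDeriv ℝ i φ

omit [FiniteDimensional ℝ V] [MeasurableSpace V] [BorelSpace V] in
theorem continuous_jetComponent (i : ℕ) (φ : Test V) : Continuous (jetComponent i φ) :=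
  test_continuous_iteratedFDeriv φ i

/-- The jet of order `N` of a test function, together with the value of a distribution. -/
noncomputable def jetGraph (g : DistOver V 𝕜) (N : ℕ) :
    Test V →ₗ[ℝ] (∀ i : Fin (N + 1), BoundedContinuousFunction V (JetComponent V i)) × 𝕜 where
  toFun φ := (fun i => BoundedContinuousFunction.ofNormedAddCommGroup (jetComponent i φ)
    (continuous_jetComponent i φ) (test_exists_bound φ i).choose
    ((test_exists_bound φ i).choose_spec.2 i le_rfl), g φ)
  map_add' φ ψ := by
    refine Prod.ext (funext fun i => BoundedContinuousFunction.ext fun x => ?_) (map_add g φ ψ)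
    exact iteratedFDeriv_add_apply
      ((test_contDiff φ).contDiffAt.of_le (by exact_mod_cast le_top))
      ((test_contDiff ψ).contDiffAt.of_le (by exact_mod_cast le_top))
  map_smul' a φ := by
    refine Prod.ext (funext fun i => BoundedContinuousFunction.ext fun x => ?_) (map_smul g a φ)
    exact iteratedFDeriv_const_smul_apply
      ((test_contDiff φ).contDiffAt.of_le (by exact_mod_cast le_top))

omit [FiniteDimensional ℝ V] [MeasurableSpace V] [BorelSpace V] in
theorem jetGraph_fst_apply (g : DistOver V 𝕜) (N : ℕ) (φ : Test V) (i : Fin (N + 1)) (x : V) :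
    (jetGraph g N φ).1 i x = jetComponent i φ x := rfl

omit [MeasurableSpace V] [BorelSpace V] in
theorem continuous_jetGraph_translate (g : DistOver V 𝕜) (N : ℕ) (φ : Test V) :
    Continuous fun x => jetGraph g N (translateTest x φ) := by
  refine Continuous.prodMk (continuous_pi fun i => ?_) (g.continuous_translate φ)
  rw [Metric.continuous_iff]
  intro x₀ ε hε
  obtain ⟨δ, hδ, h⟩ := eventually_norm_iteratedFDeriv_translate_sub_le φ N (half_pos hε)
  refine ⟨δ, hδ, fun x hx => ?_⟩
  refine ((BoundedContinuousFunction.dist_le (half_pos hε).le).2 fun y => ?_).trans_lt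
    (half_lt_self hε)
  rw [dist_eq_norm]
  have := h x x₀ (by rwa [← dist_eq_norm]) i (by omega) y
  rwa [← iteratedFDeriv_translateTest, ← iteratedFDeriv_translateTest] at this

theorem Submodule.integral_mem_topologicalClosure {E : Type*} [NormedAddCommGroup E]
    [NormedSpace ℝ E] [CompleteSpace E] (q : Submodule ℝ E) {v : V → E} (hv : Continuous v)
    (hc : HasCompactSupport v) (hq : ∀ x, v x ∈ q) [IsFiniteMeasureOnCompacts μ] :
    ∫ x, v x ∂μ ∈ q.topologicalClosure := by
  have : ProperSpace V := FiniteDimensional.proper ℝ V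
  have : CompleteSpace q.topologicalClosure :=
    q.isClosed_topologicalClosure.completeSpace_coe
  let w : V → q.topologicalClosure := fun x => ⟨v x, q.le_topologicalClosure (hq x)⟩
  have hw : Continuous w := hv.subtype_mk _
  have hwc : HasCompactSupport w := HasCompactSupport.intro hc.isCompact fun x hx =>
    Subtype.ext (image_eq_zero_of_notMem_tsupport (f := v) hx)
  have h := q.topologicalClosure.subtypeL.integral_comp_comm
    (hw.integrable_of_hasCompactSupport (μ := μ) hwc)
  have h2 : ∫ x, v x ∂μ = q.topologicalClosure.subtypeL (∫ x, w x ∂μ) := h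
  rw [h2]
  exact Subtype.property _

/-- A distribution commutes with averages of translates of a test function. -/
theorem DistOver.apply_integral_translate [IsFiniteMeasureOnCompacts μ] (g : DistOver V 𝕜)
    (φ ψ Φ : Test V) (hΦ : ∀ y, Φ y = ∫ x, ψ x • φ (x + y) ∂μ) :
    g Φ = ∫ x, ψ x • g (translateTest x φ) ∂μ := by
  have : ProperSpace V := FiniteDimensional.proper ℝ V
  obtain ⟨K, hK, hKφ⟩ := isCompact_sub_tsupport ψ.hasCompactSupport.isCompact φ
  obtain ⟨N, C, hC, hb⟩ := g.exists_bound hK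
  let p : Submodule ℝ (Test V) :=
    { carrier := {φ | ∀ x ∉ K, φ x = 0}
      add_mem' := fun {a b} ha hb x hx => by
        change a x + b x = 0
        rw [ha x hx, hb x hx, add_zero]
      zero_mem' := fun x _ => rfl
      smul_mem' := fun a b hb x hx => by
        change a • b x = 0
        rw [hb x hx, smul_zero] }
  -- The graph of `g` over `N`-jets lies in a Banach space, where vector-valued integrals exist. The
  -- order bound passes to the closure of the graph, so there the jet determines the value. The
  -- integral of the translates lies in the closure and has the same jet as `Φ`, hence also the same
  -- value.
  let q := p.map (jetGraph g N)
  have hq : ∀ e ∈ q.topologicalClosure, ‖e.2‖ ≤ C * ‖e.1‖ := by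
    have hcl : IsClosed {e : (∀ i : Fin (N + 1),
        BoundedContinuousFunction V (JetComponent V i)) × 𝕜 | ‖e.2‖ ≤ C * ‖e.1‖} :=
      isClosed_le (by fun_prop) (by fun_prop)
    refine fun e he => closure_minimal ?_ hcl he
    rintro _ ⟨χ, hχ, rfl⟩
    refine hb χ _ hχ fun i hi x => ?_
    change ‖(jetGraph g N χ).1 ⟨i, by omega⟩ x‖ ≤ _
    exact (BoundedContinuousFunction.norm_coe_le_norm _ _).trans (norm_le_pi_norm _ _)
  let v : V → (∀ i : Fin (N + 1), BoundedContinuousFunction V (JetComponent V i)) × 𝕜 :=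
    fun x => ψ x • jetGraph g N (translateTest x φ)
  have hv : Continuous v := ψ.continuous.smul (continuous_jetGraph_translate g N φ)
  have hvc : HasCompactSupport v := ψ.hasCompactSupport.smul_right
  have hvi : Integrable v μ := hv.integrable_of_hasCompactSupport hvc
  have hvq : ∀ x, v x ∈ q := by
    intro x
    by_cases hx : x ∈ tsupport ψ
    · exact q.smul_mem _ ⟨_, fun y hy => hKφ x hx y hy, rfl⟩
    · change ψ x • _ ∈ q
      rw [image_eq_zero_of_notMem_tsupport hx, zero_smul]
      exact q.zero_mem
  have hmem := Submodule.integral_mem_topologicalClosure μ q hv hvc hvq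
  have hΦp : jetGraph g N Φ ∈ q := by
    refine ⟨Φ, fun y hy => ?_, rfl⟩
    rw [hΦ]
    refine integral_eq_zero_of_ae (Eventually.of_forall fun x => ?_)
    by_cases hx : x ∈ tsupport ψ
    · simp [hKφ x hx y hy]
    · simp [image_eq_zero_of_notMem_tsupport hx]
  have h1 : (∫ x, v x ∂μ).1 = (jetGraph g N Φ).1 := by
    ext1 i
    refine BoundedContinuousFunction.ext fun y => ?_
    let L := (BoundedContinuousFunction.evalCLM ℝ y :
      BoundedContinuousFunction V (JetComponent V i) →L[ℝ] _) ∘L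
      (ContinuousLinearMap.proj (R := ℝ) (φ := fun i : Fin (N + 1) =>
        BoundedContinuousFunction V (JetComponent V i)) i) ∘L
      (ContinuousLinearMap.fst ℝ _ 𝕜)
    have h2 := L.integral_comp_comm hvi
    have h3 : iteratedFDeriv ℝ i Φ y = ∫ x, ψ x • iteratedFDeriv ℝ i φ (x + y) ∂μ := by
      rw [show (Φ : V → ℝ) = fun y => ∫ x, ψ x • φ (x + y) ∂μ from funext hΦ,
        iteratedFDeriv_integral_translate]
    refine Eq.trans ?_ (jetGraph_fst_apply g N Φ i y).symm
    refine Eq.trans ?_ h3.symm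
    refine h2.symm.trans (integral_congr_ae (Eventually.of_forall fun x => ?_))
    change ψ x • iteratedFDeriv ℝ i (translateTest x φ) y = _
    rw [iteratedFDeriv_translateTest]
  have h2 : (∫ x, v x ∂μ).2 = ∫ x, ψ x • g (translateTest x φ) ∂μ :=
    ((ContinuousLinearMap.snd ℝ _ 𝕜).integral_comp_comm hvi).symm
  have h3 := hq _ (q.topologicalClosure.sub_mem hmem (q.le_topologicalClosure hΦp))
  rw [Prod.fst_sub, Prod.snd_sub, h1, sub_self, norm_zero, mul_zero, norm_le_zero_iff,
    sub_eq_zero, h2] at h3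
  exact h3.symm

/-- The test function `y ↦ ∫ ψ x φ (x + y)`. -/
theorem exists_test_eq_integral_translate [μ.IsAddHaarMeasure] (φ ψ : Test V) :
    ∃ Φ : Test V, ∀ y, Φ y = ∫ x, ψ x • φ (x + y) ∂μ := by
  have : ProperSpace V := FiniteDimensional.proper ℝ V
  obtain ⟨K, hK, hKφ⟩ := isCompact_sub_tsupport ψ.hasCompactSupport.isCompact φ
  -- The average is the convolution of $\psi(-\,\cdot)$ with `φ`, which supplies its smoothness.
  have hc : ContDiff ℝ (⊤ : ℕ∞) (convolution (fun x => ψ (-x)) φ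
      (ContinuousLinearMap.lsmul ℝ ℝ) μ) := by
    refine φ.hasCompactSupport.contDiff_convolution_right _ ?_ (test_contDiff φ)
    exact (ψ.continuous.comp continuous_neg).locallyIntegrable
  have he : convolution (fun x => ψ (-x)) φ (ContinuousLinearMap.lsmul ℝ ℝ) μ
      = fun y => ∫ x, ψ x • φ (x + y) ∂μ := by
    ext y
    rw [convolution_def, ← integral_neg_eq_self]
    refine integral_congr_ae (Eventually.of_forall fun x => ?_)
    simp [add_comm]
  rw [he] at hc
  refine ⟨⟨_, hc, HasCompactSupport.intro hK fun y hy => ?_, fun _ _ => trivial⟩, fun y => rfl⟩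
  refine integral_eq_zero_of_ae (Eventually.of_forall fun x => ?_)
  by_cases hx : x ∈ tsupport ψ
  · simp [hKφ x hx y hy]
  · simp [image_eq_zero_of_notMem_tsupport hx]

end Regularization

/-! ### Vector-valued polynomial functions of bounded degree -/

section PolynomialFunctions

variable {𝕜 : Type*} [RCLike 𝕜] {V : Type*} [NormedAddCommGroup V] [NormedSpace ℝ V]
  {n : ℕ}

/-- The monomial function `∏ k, x_{m k}` in the coordinates of a basis. -/
noncomputable def coordMonomial (b : Module.Basis (Fin n) ℝ V) {d : ℕ} (m : Fin d → Fin n)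
    (x : V) : ℝ :=
  ∏ k, b.coord (m k) x

variable (𝕜) in
/-- Polynomial functions of degree less than `N` with values in `𝕜`. -/
noncomputable def polyFunctions (b : Module.Basis (Fin n) ℝ V) (N : ℕ) :
    Submodule ℝ (V → 𝕜) :=
  Submodule.span ℝ {p | ∃ d < N, ∃ (m : Fin d → Fin n) (a : 𝕜),
    p = fun x => coordMonomial b m x • a}

variable {b : Module.Basis (Fin n) ℝ V}

theorem coordMonomial_mem {N d : ℕ} (hd : d < N) (m : Fin d → Fin n) (a : 𝕜) :
    (fun x => coordMonomial b m x • a) ∈ polyFunctions 𝕜 b N :=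
  Submodule.subset_span ⟨d, hd, m, a, rfl⟩

theorem const_mem_polyFunctions (N : ℕ) (a : 𝕜) :
    (fun _ => a) ∈ polyFunctions 𝕜 b (N + 1) := by
  have h := coordMonomial_mem (b := b) (N := N + 1) (Nat.succ_pos N) Fin.elim0 a
  simpa [coordMonomial] using h

theorem coord_smul_mem_polyFunctions {N : ℕ} (i : Fin n) {p : V → 𝕜}
    (hp : p ∈ polyFunctions 𝕜 b N) :
    (fun x => b.coord i x • p x) ∈ polyFunctions 𝕜 b (N + 1) := by
  induction hp using Submodule.span_induction with
  | mem p hp =>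
    obtain ⟨d, hd, m, a, rfl⟩ := hp
    have h := coordMonomial_mem (b := b) (N := N + 1) (Nat.succ_lt_succ hd)
      (Fin.cons i m : Fin (d + 1) → Fin n) a
    simpa only [coordMonomial, Fin.prod_univ_succ, Fin.cons_zero, Fin.cons_succ,
      mul_smul] using h
  | zero =>
    simp only [Pi.zero_apply, smul_zero]
    exact (polyFunctions 𝕜 b (N + 1)).zero_mem
  | add p q _ _ hp hq =>
    simp only [Pi.add_apply, smul_add]
    exact (polyFunctions 𝕜 b (N + 1)).add_mem hp hq
  | smul a p _ hp =>
    simp only [Pi.smul_apply, smul_comm _ a]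
    exact (polyFunctions 𝕜 b (N + 1)).smul_mem a hp

variable [FiniteDimensional ℝ V]

theorem continuous_coordMonomial {d : ℕ} (m : Fin d → Fin n) :
    Continuous (coordMonomial b m) :=
  continuous_finsetProd _ fun _ _ => LinearMap.continuous_of_finiteDimensional _

theorem continuous_of_mem_polyFunctions {N : ℕ} {p : V → 𝕜} (hp : p ∈ polyFunctions 𝕜 b N) :
    Continuous p := by
  induction hp using Submodule.span_induction with
  | mem p hp =>
    obtain ⟨d, hd, m, a, rfl⟩ := hp
    exact (continuous_coordMonomial m).smul continuous_const
  | zero => exact continuous_const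
  | add p q _ _ hp hq => exact hp.add hq
  | smul a p _ hp => exact hp.const_smul a

/-- The integration multiplies a monomial of degree $d$ by $1/(d+1)$. It is what the fundamental
theorem of calculus along the segment from $0$ to $x$ produces. -/
theorem integral_smul_mem_polyFunctions {N : ℕ} {p : V → 𝕜}
    (hp : p ∈ polyFunctions 𝕜 b N) :
    (fun x => ∫ t in (0 : ℝ)..1, p (t • x)) ∈ polyFunctions 𝕜 b N := by
  induction hp using Submodule.span_induction with
  | mem p hp =>
    obtain ⟨d, hd, m, a, rfl⟩ := hp
    have h := coordMonomial_mem (b := b) hd m (((d : ℝ) + 1)⁻¹ • a)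
    refine (congrArg (· ∈ polyFunctions 𝕜 b N) ?_).mp h
    ext x
    have h1 : ∀ t : ℝ, coordMonomial b m (t • x) = t ^ d * coordMonomial b m x := fun t => by
      simp [coordMonomial, Finset.prod_mul_distrib]
    simp only [h1]
    rw [intervalIntegral.integral_smul_const, intervalIntegral.integral_mul_const, integral_pow,
      smul_smul]
    congr 1
    simp
    ring
  | zero =>
    simp only [Pi.zero_apply, intervalIntegral.integral_zero]
    exact (polyFunctions 𝕜 b N).zero_mem
  | add p q hp' hq' hp hq =>
    have h := (polyFunctions 𝕜 b N).add_mem hp hq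
    refine (congrArg (· ∈ polyFunctions 𝕜 b N) ?_).mp h
    ext x
    have hc : ∀ {p}, p ∈ polyFunctions 𝕜 b N →
        IntervalIntegrable (fun t : ℝ => p (t • x)) volume 0 1 := fun hp =>
      ((continuous_of_mem_polyFunctions hp).comp (by fun_prop)).intervalIntegrable _ _
    exact (intervalIntegral.integral_add (hc hp') (hc hq')).symm
  | smul a p _ hp =>
    have h := (polyFunctions 𝕜 b N).smul_mem a hp
    refine (congrArg (· ∈ polyFunctions 𝕜 b N) ?_).mp h
    ext x
    exact (intervalIntegral.integral_smul a _).symm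

theorem integral_test_smul_polyFunctions_eq_zero [MeasurableSpace V] [BorelSpace V]
    (μ : Measure V) [IsFiniteMeasureOnCompacts μ] {N : ℕ} (φ : Test V)
    (hφ : ∀ d < N, ∀ m : Fin d → Fin n, ∫ x, φ x • coordMonomial b m x ∂μ = 0) {p : V → 𝕜}
    (hp : p ∈ polyFunctions 𝕜 b N) : ∫ x, φ x • p x ∂μ = 0 := by
  induction hp using Submodule.span_induction with
  | mem p hp =>
    obtain ⟨d, hd, m, a, rfl⟩ := hp
    simp only [← smul_assoc]
    rw [integral_smul_const, hφ d hd m, zero_smul]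
  | zero => simp
  | add p q hp' hq' hp hq =>
    simp only [Pi.add_apply, smul_add]
    rw [integral_add (integrable_test_smul μ φ (continuous_of_mem_polyFunctions hp'))
      (integrable_test_smul μ φ (continuous_of_mem_polyFunctions hq')), hp, hq, add_zero]
  | smul a p _ hp =>
    simp only [Pi.smul_apply, smul_comm _ a]
    rw [integral_smul, hp, smul_zero]

omit [FiniteDimensional ℝ V] in
theorem neg_mem_polyFunctions {N : ℕ} {p : V → 𝕜} (hp : p ∈ polyFunctions 𝕜 b N) :
    (fun x => p (-x)) ∈ polyFunctions 𝕜 b N := by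
  induction hp using Submodule.span_induction with
  | mem p hp =>
    obtain ⟨d, hd, m, a, rfl⟩ := hp
    have h := coordMonomial_mem (b := b) hd m ((-1 : ℝ) ^ d • a)
    refine (congrArg (· ∈ polyFunctions 𝕜 b N) ?_).mp h
    ext x
    simp [coordMonomial, Finset.prod_neg, smul_smul, mul_comm]
  | zero => exact (polyFunctions 𝕜 b N).zero_mem
  | add p q _ _ hp hq => exact (polyFunctions 𝕜 b N).add_mem hp hq
  | smul a p _ hp => exact (polyFunctions 𝕜 b N).smul_mem a hp

end PolynomialFunctions

/-! ### Distributions annihilated by long products of derivatives are polynomial -/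

section PolynomialDistributions

variable {𝕜 : Type*} [RCLike 𝕜] {V : Type*} [NormedAddCommGroup V] [NormedSpace ℝ V]

/-- All products of `N` directional derivatives annihilate the distribution. -/
def DerivsVanish : ℕ → DistOver V 𝕜 → Prop
  | 0, g => g = 0
  | N + 1, g => ∀ v : V, DerivsVanish N (∂_{v} g)

variable [FiniteDimensional ℝ V] {n : ℕ}

/-- Integrating the derivative along the segment from $0$ to $x$ gives $g(\varphi)-\sum_i
x_i\int_0^1(\partial_ig)(\varphi(tx+\cdot))\,dt$. By induction each integrand is polynomial of
degree below `N`, and the factor $x_i$ costs one degree. -/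
theorem DerivsVanish.translate_mem_polyFunctions (b : Module.Basis (Fin n) ℝ V) {N : ℕ}
    {g : DistOver V 𝕜} (hg : DerivsVanish N g) (φ : Test V) :
    (fun x => g (translateTest x φ)) ∈ polyFunctions 𝕜 b N := by
  induction N generalizing g with
  | zero =>
    have h0 : g = 0 := hg
    subst h0
    exact (polyFunctions 𝕜 b 0).zero_mem
  | succ N ih =>
    have hp := fun i => ih (hg (b i))
    have key : ∀ x, g (translateTest x φ) = g φ - ∑ i, b.coord i x •
        ∫ t in (0 : ℝ)..1, (∂_{b i} g : DistOver V 𝕜) (translateTest (t • x) φ) := by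
      intro x
      have h1 := intervalIntegral.integral_eq_sub_of_hasDerivAt (a := 0) (b := 1)
        (fun t _ => g.hasDerivAt_translate φ 0 x t)
        (((g.continuous_translate (∂_{x} φ)).comp (by fun_prop)).intervalIntegrable 0 1)
      simp only [zero_add, one_smul, zero_smul, translateTest_zero] at h1
      have h2 : ∀ t : ℝ, g (translateTest (t • x) (∂_{x} φ))
          = - ∑ i, b.coord i x • (∂_{b i} g : DistOver V 𝕜) (translateTest (t • x) φ) := by
        intro t
        have h3 : (∂_{x} φ : Test V) = ∑ i, b.coord i x • (∂_{b i} φ : Test V) := by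
          conv_lhs => rw [← b.sum_repr x]
          ext y
          rw [lineDeriv_test_apply, map_sum, FunLike.coe_sum, Finset.sum_apply]
          refine Finset.sum_congr rfl fun i _ => ?_
          rw [map_smul, ← lineDeriv_test_apply]
          rfl
        have h4 : ∀ i, (∂_{b i} g : DistOver V 𝕜) (translateTest (t • x) φ)
            = - g (translateTest (t • x) (∂_{b i} φ)) := fun i => by
          rw [Distribution.lineDerivOp_apply_apply, map_neg, translateTest_lineDeriv]
        simp only [h4]
        have h5 : translateTest (t • x) (∂_{x} φ)
            = ∑ i, b.coord i x • translateTest (t • x) (∂_{b i} φ) := by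
          rw [h3]
          ext y
          simp
        rw [h5, map_sum]
        simp only [map_smul, smul_neg, Finset.sum_neg_distrib, neg_neg]
      simp only [h2] at h1
      rw [intervalIntegral.integral_neg, intervalIntegral.integral_finsetSum] at h1
      · simp only [intervalIntegral.integral_smul] at h1
        rw [sub_eq_add_neg, h1]
        abel
      · intro i _
        exact ((((∂_{b i} g : DistOver V 𝕜).continuous_translate φ).comp
          (by fun_prop : Continuous fun t : ℝ => t • x)).const_smul _).intervalIntegrable 0 1
    have h : (fun x => g (translateTest x φ)) = (fun _ => g φ) - ∑ i, fun x => b.coord i x •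
        ∫ t in (0 : ℝ)..1, (∂_{b i} g : DistOver V 𝕜) (translateTest (t • x) φ) := by
      ext x
      rw [key x]
      simp
    rw [h]
    exact (polyFunctions 𝕜 b (N + 1)).sub_mem (const_mem_polyFunctions N _)
      (Submodule.sum_mem _ fun i _ =>
        coord_smul_mem_polyFunctions i (integral_smul_mem_polyFunctions (hp i)))

variable [MeasurableSpace V] [BorelSpace V] (μ : Measure V) [μ.IsAddHaarMeasure]

/-- Averaging $x\mapsto g(\varphi(x+\cdot))$ against any `ψ` can be rewritten as integrating `φ`
against a polynomial of degree below `N`, which gives zero. Letting `ψ` concentrate at the origin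
recovers $g(\varphi)$. -/
theorem DerivsVanish.apply_eq_zero (b : Module.Basis (Fin n) ℝ V) {N : ℕ}
    {g : DistOver V 𝕜} (hg : DerivsVanish N g) (φ : Test V)
    (hφ : ∀ d < N, ∀ m : Fin d → Fin n, ∫ x, φ x • coordMonomial b m x ∂μ = 0) :
    g φ = 0 := by
  have : ProperSpace V := FiniteDimensional.proper ℝ V
  have key : ∀ ψ : Test V, ∫ x, ψ x • g (translateTest x φ) ∂μ = 0 := by
    intro ψ
    obtain ⟨Φ, hΦ⟩ := exists_test_eq_integral_translate μ φ ψ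
    rw [← g.apply_integral_translate μ φ ψ Φ hΦ]
    -- A change of variables lets the two functions trade roles: `Φ` is also the average of the
    -- translates of `ψ'` with weight `φ'`.
    let ψ' : Test V := ⟨fun x => ψ (-x), (test_contDiff ψ).comp contDiff_neg,
      ψ.hasCompactSupport.comp_homeomorph (Homeomorph.neg V), fun _ _ => trivial⟩
    let φ' : Test V := ⟨fun x => φ (-x), (test_contDiff φ).comp contDiff_neg,
      φ.hasCompactSupport.comp_homeomorph (Homeomorph.neg V), fun _ _ => trivial⟩
    have hΦ' : ∀ y, Φ y = ∫ x, φ' x • ψ' (x + y) ∂μ := by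
      intro y
      rw [hΦ, ← integral_sub_right_eq_self _ y, ← integral_neg_eq_self]
      refine integral_congr_ae (Eventually.of_forall fun x => ?_)
      change ψ (-x - y) • φ (-x - y + y) = φ (-x) • ψ (-(x + y))
      rw [sub_add_cancel, neg_add', smul_eq_mul, smul_eq_mul, mul_comm]
    rw [g.apply_integral_translate μ ψ' φ' Φ hΦ', ← integral_neg_eq_self]
    have h1 := neg_mem_polyFunctions (hg.translate_mem_polyFunctions b ψ')
    have h2 := integral_test_smul_polyFunctions_eq_zero μ φ hφ h1
    refine Eq.trans (integral_congr_ae (Eventually.of_forall fun x => ?_)) h2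
    change φ (- -x) • _ = _
    rw [neg_neg]
  have hcont := g.continuous_translate φ
  refine norm_le_zero_iff.1 (le_of_forall_pos_le_add fun ε hε => ?_)
  rw [zero_add]
  obtain ⟨δ, hδ, hδε⟩ := Metric.continuous_iff.1 hcont 0 ε hε
  let f : ContDiffBump (0 : V) := ⟨δ / 2, δ, by positivity, by linarith⟩
  let ψ : Test V := ⟨f.normed μ, f.contDiff_normed, f.hasCompactSupport_normed,
    fun _ _ => trivial⟩
  -- The bump has mass one, and `key` makes the subtracted average vanish.
  have h1 : g φ = ∫ x, ψ x • (g φ - g (translateTest x φ)) ∂μ := by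
    simp only [smul_sub]
    rw [integral_sub (integrable_test_smul μ ψ continuous_const)
      (integrable_test_smul μ ψ hcont), key ψ, integral_smul_const]
    change _ = (∫ x, f.normed μ x ∂μ) • g φ - 0
    rw [f.integral_normed, one_smul, sub_zero]
  have h2 : ∫ x, ψ x * ε ∂μ = ε := by
    rw [integral_mul_const]
    change (∫ x, f.normed μ x ∂μ) * ε = ε
    rw [f.integral_normed, one_mul]
  rw [h1]
  refine (norm_integral_le_of_norm_le (by
    simpa using integrable_test_smul μ ψ (A := fun _ => ε) continuous_const)
    (Eventually.of_forall fun x => ?_)).trans h2.le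
  have hψ : 0 ≤ ψ x := f.nonneg_normed x
  rw [norm_smul, Real.norm_of_nonneg hψ]
  by_cases hx : x ∈ Metric.ball (0 : V) δ
  · refine mul_le_mul_of_nonneg_left ?_ hψ
    have := (hδε x (by simpa using hx)).le
    rwa [translateTest_zero, dist_comm, dist_eq_norm] at this
  · have : ψ x = 0 := by
      by_contra hne
      exact hx (f.support_normed_eq (μ := μ) ▸ hne : x ∈ Metric.ball (0 : V) f.rOut)
    rw [this]
    simp

/-- A distribution annihilated by all products of `N` directional derivatives is a polynomial
density. -/
theorem DerivsVanish.isPolynomialDensity {N : ℕ} {g : DistOver V 𝕜} (hg : DerivsVanish N g) :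
    IsPolynomialDensity μ g := by
  have : ProperSpace V := FiniteDimensional.proper ℝ V
  let b := Module.finBasis ℝ V
  let I := Σ d : Fin N, Fin d → Fin (Module.finrank ℝ V)
  have hint : ∀ (σ : I) (φ : Test V),
      Integrable (fun x => φ x • coordMonomial b σ.2 x) μ := fun σ φ =>
    integrable_test_smul μ φ (continuous_coordMonomial _)
  let L : I → Test V →ₗ[ℝ] ℝ := fun σ =>
    { toFun := fun φ => ∫ x, φ x • coordMonomial b σ.2 x ∂μ
      map_add' := fun φ ψ => by
        rw [← integral_add (hint σ φ) (hint σ ψ)]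
        refine integral_congr_ae (Eventually.of_forall fun x => ?_)
        exact add_smul (φ x) (ψ x) _
      map_smul' := fun a φ => by
        rw [RingHom.id_apply, ← integral_smul]
        refine integral_congr_ae (Eventually.of_forall fun x => ?_)
        exact smul_assoc a (φ x) _ }
  have hL : ∀ T : 𝕜 →ₗ[ℝ] ℝ, ∃ a : I → ℝ, ∀ φ, T (g φ) = ∑ σ, a σ * L σ φ := by
    intro T
    -- A functional vanishing on the common kernel of finitely many functionals is a linear
    -- combination of them; here these are the moments of degree below `N`.
    have h1 : ⨅ σ, LinearMap.ker (L σ) ≤ LinearMap.ker (T ∘ₗ g.toLinearMap) := by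
      intro φ hφ
      rw [Submodule.mem_iInf] at hφ
      have h0 : g φ = 0 := hg.apply_eq_zero μ b φ fun d hd m => hφ ⟨⟨d, hd⟩, m⟩
      change T (g φ) = 0
      rw [h0, map_zero]
    obtain ⟨a, ha⟩ := (Submodule.mem_span_range_iff_exists_fun ℝ).1
      (mem_span_of_iInf_ker_le_ker h1)
    refine ⟨a, fun φ => ?_⟩
    have := LinearMap.congr_fun ha φ
    simp only [LinearMap.sum_apply, LinearMap.smul_apply, smul_eq_mul] at this
    exact this.symm
  obtain ⟨a₁, h₁⟩ := hL (RCLike.reLm : 𝕜 →ₗ[ℝ] ℝ)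
  obtain ⟨a₂, h₂⟩ := hL (RCLike.imLm : 𝕜 →ₗ[ℝ] ℝ)
  refine ⟨∑ σ : I, MvPolynomial.C ((a₁ σ : 𝕜) + (a₂ σ : 𝕜) * RCLike.I) *
    ∏ k, MvPolynomial.X (b.coord (σ.2 k)), fun φ => ?_⟩
  have hev : ∀ x, φ x • MvPolynomial.eval (fun l : Module.Dual ℝ V => ((l x : ℝ) : 𝕜))
      (∑ σ : I, MvPolynomial.C ((a₁ σ : 𝕜) + (a₂ σ : 𝕜) * RCLike.I) *
        ∏ k, MvPolynomial.X (b.coord (σ.2 k)))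
      = ∑ σ : I, (φ x • coordMonomial b σ.2 x) •
        ((a₁ σ : 𝕜) + (a₂ σ : 𝕜) * RCLike.I) := by
    intro x
    rw [map_sum, Finset.smul_sum]
    refine Finset.sum_congr rfl fun σ _ => ?_
    rw [map_mul, map_prod, MvPolynomial.eval_C, smul_assoc]
    congr 1
    simp only [MvPolynomial.eval_X, coordMonomial, RCLike.real_smul_eq_coe_mul]
    push_cast
    ring
  simp only [hev]
  rw [integral_finsetSum _ fun σ _ => (hint σ φ).smul_const _]
  simp only [integral_smul_const]
  have h₁' : RCLike.re (g φ) = ∑ σ, a₁ σ * L σ φ := h₁ φ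
  have h₂' : RCLike.im (g φ) = ∑ σ, a₂ σ * L σ φ := h₂ φ
  rw [← RCLike.re_add_im (g φ), h₁', h₂']
  push_cast
  rw [Finset.sum_mul, ← Finset.sum_add_distrib]
  refine Finset.sum_congr rfl fun σ _ => ?_
  change _ = L σ φ • _
  rw [RCLike.real_smul_eq_coe_mul]
  ring

end PolynomialDistributions

section

open scoped Classical

/-! ### Algebra of the operators $\partial_Y$ -/

section Derivatives

variable {𝕜 : Type*} [RCLike 𝕜] {V : Type*} [NormedAddCommGroup V] [NormedSpace ℝ V]
  {ι : Type*} (X : ι → V)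

theorem derivAlong_empty (T : DistOver V 𝕜) : derivAlong 𝕜 X ∅ T = T := by
  simp [derivAlong]

theorem derivAlong_insert {i : ι} {S : Finset ι} (hi : i ∉ S) (T : DistOver V 𝕜) :
    derivAlong 𝕜 X (insert i S) T = ∂_{X i} (derivAlong 𝕜 X S T) := by
  rw [derivAlong, Finset.noncommProd_insert_of_notMem _ _ _ _ hi]
  rfl

theorem derivAlong_union {S S' : Finset ι} (h : Disjoint S S') (T : DistOver V 𝕜) :
    derivAlong 𝕜 X (S ∪ S') T = derivAlong 𝕜 X S (derivAlong 𝕜 X S' T) := by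
  rw [derivAlong, Finset.noncommProd_union_of_disjoint h]
  rfl

variable {X}

theorem derivAlong_eq_zero_of_subset {Y Z : Finset ι} (h : Y ⊆ Z) {T : DistOver V 𝕜}
    (hT : derivAlong 𝕜 X Y T = 0) : derivAlong 𝕜 X Z T = 0 := by
  rw [← Finset.sdiff_union_of_subset h, derivAlong_union X Finset.sdiff_disjoint, hT, map_zero]

theorem distOn_sub_mem {r : Submodule ℝ V} {S T : DistOver V 𝕜} (hS : S ∈ distOn 𝕜 r)
    (hT : T ∈ distOn 𝕜 r) : S - T ∈ distOn 𝕜 r := by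
  intro φ hφ
  change S φ - T φ = 0
  rw [hS φ hφ, hT φ hφ, sub_zero]

theorem zero_mem_distOn (r : Submodule ℝ V) : (0 : DistOver V 𝕜) ∈ distOn 𝕜 r :=
  fun _ _ => rfl

theorem DerivsVanish.zero : ∀ N, DerivsVanish N (0 : DistOver V 𝕜)
  | 0 => rfl
  | N + 1 => fun v => by
    have h : (∂_{v} (0 : DistOver V 𝕜)) = 0 := map_zero (dirDeriv 𝕜 v)
    rw [h]
    exact DerivsVanish.zero N

theorem DerivsVanish.add : ∀ {N} {S T : DistOver V 𝕜}, DerivsVanish N S → DerivsVanish N T →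
    DerivsVanish N (S + T)
  | 0, S, T, hS, hT => by
    change S + T = 0
    rw [show S = 0 from hS, show T = 0 from hT, add_zero]
  | N + 1, S, T, hS, hT => fun v => by
    rw [LineDeriv.lineDerivOp_add]
    exact (hS v).add (hT v)

theorem DerivsVanish.smul : ∀ {N} (a : ℝ) {S : DistOver V 𝕜}, DerivsVanish N S →
    DerivsVanish N (a • S)
  | 0, a, S, hS => by
    change a • S = 0
    rw [show S = 0 from hS]
    ext φ
    exact smul_zero a
  | N + 1, a, S, hS => fun v => by
    rw [LineDeriv.lineDerivOp_smul]
    exact (hS v).smul a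

end Derivatives

/-! ### Sublists, rational subspaces and cocircuits -/

section Sublists

variable {V : Type*} [NormedAddCommGroup V] [NormedSpace ℝ V] {ι : Type*} {X : ι → V}

theorem spanOf_mono {S T : Finset ι} (h : S ⊆ T) : spanOf X S ≤ spanOf X T :=
  Submodule.span_mono (Set.image_mono (by exact_mod_cast h))

theorem mem_spanOf {S : Finset ι} {i : ι} (hi : i ∈ S) : X i ∈ spanOf X S :=
  Submodule.subset_span ⟨i, hi, rfl⟩

theorem spanOf_le {S : Finset ι} {r : Submodule ℝ V} (h : ∀ i ∈ S, X i ∈ r) :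
    spanOf X S ≤ r := by
  rw [spanOf, Submodule.span_le]
  rintro _ ⟨i, hi, rfl⟩
  exact h i hi

theorem exists_isCocircuit_subset {S Z : Finset ι} (hZ : Z ⊆ S)
    (h : spanOf X (S \ Z) ≠ spanOf X S) : ∃ Y ⊆ Z, IsCocircuit X S Y := by
  obtain ⟨Y, hY, hmin⟩ := exists_minimal_le_of_wellFoundedLT
    (fun Z : Finset ι => Z ⊆ S ∧ spanOf X (S \ Z) ≠ spanOf X S) Z ⟨hZ, h⟩
  exact ⟨Y, hY, hmin⟩

variable [Fintype ι]

theorem mem_insideList {r : Submodule ℝ V} {i : ι} : i ∈ insideList X r ↔ X i ∈ r := by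
  simp [insideList]

theorem mem_outsideList {r : Submodule ℝ V} {i : ι} : i ∈ outsideList X r ↔ X i ∉ r := by
  simp [outsideList]

theorem spanOf_mem_rationalSubspaces (S : Finset ι) : spanOf X S ∈ rationalSubspaces X :=
  Finset.mem_image.2 ⟨S, Finset.mem_univ _, rfl⟩

theorem spanOf_insideList {r : Submodule ℝ V} (hr : r ∈ rationalSubspaces X) :
    spanOf X (insideList X r) = r := by
  obtain ⟨S, -, rfl⟩ := Finset.mem_image.1 hr
  exact le_antisymm (spanOf_le fun i hi => mem_insideList.1 hi)
    (spanOf_mono fun i hi => mem_insideList.2 (mem_spanOf hi))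

theorem insideList_top : insideList X ⊤ = Finset.univ := by
  ext i
  simp [mem_insideList]

theorem outsideList_top : outsideList X ⊤ = ∅ := by
  ext i
  simp [mem_outsideList]

end Sublists

/-! ### Dahmen–Micchelli spaces -/

section DahmenMicchelli

variable {𝕜 : Type*} [RCLike 𝕜] {V : Type*} [NormedAddCommGroup V] [NormedSpace ℝ V]
  {ι : Type*} {X : ι → V}

theorem derivAlong_eq_zero_of_spanOf_ne {S Z : Finset ι} {g : DistOver V 𝕜}
    (hg : g ∈ dahmenMicchelli 𝕜 X S) (hZ : Z ⊆ S) (h : spanOf X (S \ Z) ≠ spanOf X S) :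
    derivAlong 𝕜 X Z g = 0 := by
  obtain ⟨Y, hYZ, hY⟩ := exists_isCocircuit_subset hZ h
  exact derivAlong_eq_zero_of_subset hYZ (hg.2 Y hY)

theorem dahmenMicchelli_sub_mem {S : Finset ι} {g g' : DistOver V 𝕜}
    (hg : g ∈ dahmenMicchelli 𝕜 X S) (hg' : g' ∈ dahmenMicchelli 𝕜 X S) :
    g - g' ∈ dahmenMicchelli 𝕜 X S :=
  ⟨distOn_sub_mem hg.1 hg'.1, fun Y hY => by rw [map_sub, hg.2 Y hY, hg'.2 Y hY, sub_zero]⟩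

variable [Fintype ι]

/-- Deleting $(X\cap r)\setminus r'$ from $X\cap r$ leaves vectors of $r'$, which cannot span $r$.
So $X\setminus r'$ contains a cocircuit of $X\cap r$. -/
theorem derivAlong_outsideList_eq_zero {r r' : Submodule ℝ V} (hr : r ∈ rationalSubspaces X)
    (h : ¬ r ≤ r') {g : DistOver V 𝕜} (hg : g ∈ dahmenMicchelli 𝕜 X (insideList X r)) :
    derivAlong 𝕜 X (outsideList X r') g = 0 := by
  refine derivAlong_eq_zero_of_subset (Y := insideList X r \ insideList X r') (fun i hi => ?_)
    (derivAlong_eq_zero_of_spanOf_ne hg Finset.sdiff_subset fun he => h ?_)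
  · rw [Finset.mem_sdiff] at hi
    exact mem_outsideList.2 fun hi' => hi.2 (mem_insideList.2 hi')
  · rw [spanOf_insideList hr] at he
    rw [← he]
    refine spanOf_le fun i hi => ?_
    simp only [Finset.mem_sdiff, not_and, not_not] at hi
    exact mem_insideList.1 (hi.2 hi.1)

/-- Induction on $|S|$. If `S` does not span, $\partial_{X\setminus S}g$ is already zero. If it
does, any direction is a combination of the $X_i$ with $i\in S$, and differentiating along $X_i$
moves $i$ from `S` to its complement. The case of all of `X` bounds the degree of `g`. -/
theorem derivsVanish_derivAlong_of_mem_dahmenMicchelli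
    (hX : Submodule.span ℝ (Set.range X) = ⊤) {g : DistOver V 𝕜}
    (hg : g ∈ dahmenMicchelli 𝕜 X Finset.univ) (S : Finset ι) :
    DerivsVanish (S.card + 1) (derivAlong 𝕜 X (Finset.univ \ S) g) := by
  have htop : spanOf X Finset.univ = ⊤ := by simpa [spanOf] using hX
  induction hk : S.card generalizing S with
  | zero =>
    rw [Finset.card_eq_zero] at hk
    subst hk
    intro v
    -- The empty list spans only when $V=0$; the extra derivative is then along the zero vector.
    by_cases hS : spanOf X ∅ = ⊤
    · have hv : v = 0 := by
        have : v ∈ spanOf X ∅ := hS ▸ Submodule.mem_top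
        simpa [spanOf] using this
      subst hv
      have h : (∂_{(0 : V)} (derivAlong 𝕜 X (Finset.univ \ ∅) g)) = 0 := by simp
      exact h
    · have h : derivAlong 𝕜 X (Finset.univ \ ∅) g = 0 :=
        derivAlong_eq_zero_of_spanOf_ne hg (Finset.subset_univ _) (by simpa [htop] using hS)
      rw [h]
      exact DerivsVanish.zero 1 v
  | succ k ih =>
    intro v
    by_cases hS : spanOf X S = ⊤
    · have hv : v ∈ spanOf X S := hS ▸ Submodule.mem_top
      induction hv using Submodule.span_induction with
      | mem v hv =>
        obtain ⟨i, hi, rfl⟩ := hv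
        have hi' : i ∈ S := hi
        rw [← derivAlong_insert X (by simp [hi'])]
        have h1 : insert i (Finset.univ \ S) = Finset.univ \ S.erase i := by
          ext j
          simp only [Finset.mem_insert, Finset.mem_sdiff, Finset.mem_univ, true_and,
            Finset.mem_erase]
          tauto
        rw [h1]
        exact ih _ (by rw [Finset.card_erase_of_mem hi', hk]; rfl)
      | zero =>
        have h : (∂_{(0 : V)} (derivAlong 𝕜 X (Finset.univ \ S) g)) = 0 := by simp
        rw [h]
        exact DerivsVanish.zero _
      | add v w _ _ hv hw =>
        rw [LineDeriv.lineDerivOp_left_add]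
        exact hv.add hw
      | smul a v _ hv =>
        rw [LineDeriv.lineDerivOp_left_smul]
        exact hv.smul a
    · have h : derivAlong 𝕜 X (Finset.univ \ S) g = 0 :=
        derivAlong_eq_zero_of_spanOf_ne hg (Finset.subset_univ _) (by simpa [htop] using hS)
      rw [h]
      exact DerivsVanish.zero (k + 2) v

end DahmenMicchelli

/-! ### Regular faces and the triangular action of derivatives on face components -/

section Faces

variable {𝕜 : Type*} [RCLike 𝕜] {V : Type*} [NormedAddCommGroup V] [NormedSpace ℝ V]
  {ι : Type*} [Fintype ι] {X : ι → V} {r : Submodule ℝ V} {F : Set (Module.Dual ℝ V)}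

theorem negativeList_subset : negativeList X r F ⊆ outsideList X r := Finset.filter_subset _ _

/-- Every element of a regular face is positive on the flipped family. -/
theorem IsRegularFace.flippedFamily_pos (hF : IsRegularFace X r F) {w : Module.Dual ℝ V}
    (hw : w ∈ F) : w ∈ r.dualAnnihilator ∧
      ∀ i ∈ outsideList X r, 0 < w (flippedFamily X r F i) := by
  obtain ⟨u, -, hu0, rfl⟩ := hF
  refine ⟨hw.1, fun i hi => ?_⟩
  have hsw := hw.2 i hi
  rcases lt_or_gt_of_ne (hu0 i hi) with h | h
  · have hneg : i ∈ negativeList X r {w | w ∈ r.dualAnnihilator ∧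
        ∀ i ∈ outsideList X r, SignType.sign (w (X i)) = SignType.sign (u (X i))} := by
      refine Finset.mem_filter.2 ⟨hi, fun w' hw' => ?_⟩
      have := hw'.2 i hi
      rwa [sign_neg h, sign_eq_neg_one_iff] at this
    rw [sign_neg h, sign_eq_neg_one_iff] at hsw
    rw [flippedFamily, if_pos hneg, map_neg]
    linarith
  · rw [sign_pos h, sign_eq_one_iff] at hsw
    have hneg : i ∉ negativeList X r {w | w ∈ r.dualAnnihilator ∧
        ∀ i ∈ outsideList X r, SignType.sign (w (X i)) = SignType.sign (u (X i))} := by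
      intro hi'
      exact absurd ((Finset.mem_filter.1 hi').2 w hw) (not_lt.2 hsw.le)
    rwa [flippedFamily, if_neg hneg]

theorem IsRegularFace.nonempty (hF : IsRegularFace X r F) : F.Nonempty := by
  obtain ⟨u, hu, hu0, rfl⟩ := hF
  exact ⟨u, hu, fun _ _ => rfl⟩

variable [MeasurableSpace V] {g h : DistOver V 𝕜}

theorem IsSplineConvolution.sub {g' h' : DistOver V 𝕜} (H : IsSplineConvolution X r F g h)
    (H' : IsSplineConvolution X r F g' h') :
    IsSplineConvolution X r F (g - g') (h - h') := by
  refine fun φ => ⟨(H φ).1.sub (H' φ).1, ?_⟩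
  change h φ - h' φ = _ * ∫ x, g (translateTest x φ) - g' (translateTest x φ) ∂_
  rw [integral_sub (H φ).1 (H' φ).1, (H φ).2, (H' φ).2, mul_sub]

theorem faceComponent_sub_mem {h' : DistOver V 𝕜} (H : h ∈ faceComponent 𝕜 X r F)
    (H' : h' ∈ faceComponent 𝕜 X r F) : h - h' ∈ faceComponent 𝕜 X r F := by
  obtain ⟨g, hg, hc⟩ := H
  obtain ⟨g', hg', hc'⟩ := H'
  exact ⟨g - g', dahmenMicchelli_sub_mem hg hg', hc.sub hc'⟩

theorem IsSplineConvolution.eq_zero (H : IsSplineConvolution X r F (0 : DistOver V 𝕜) h) :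
    h = 0 := by
  ext φ
  rw [(H φ).2]
  change _ * ∫ x, (0 : 𝕜) ∂_ = (0 : 𝕜)
  simp

/-- Differentiation commutes with translation, so the derivatives can all be placed on the factor
`g`. -/
theorem IsSplineConvolution.derivAlong_apply (H : IsSplineConvolution X r F g h)
    (Y : Finset ι) (φ : Test V) :
    derivAlong 𝕜 X Y h φ = (-1) ^ (negativeList X r F).card *
      ∫ x, derivAlong 𝕜 X Y g (translateTest x φ)
        ∂(splineMeasure (outsideList X r) (flippedFamily X r F)) := by
  induction Y using Finset.induction_on generalizing φ with
  | empty => rw [derivAlong_empty, derivAlong_empty, (H φ).2]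
  | insert i S hi ih =>
    simp only [derivAlong_insert X hi, Distribution.lineDerivOp_apply_apply, map_neg]
    rw [ih, integral_neg, mul_neg]
    simp only [translateTest_lineDeriv]

theorem IsSplineConvolution.derivAlong_eq_zero (H : IsSplineConvolution X r F g h)
    {Y : Finset ι} (hY : derivAlong 𝕜 X Y g = 0) : derivAlong 𝕜 X Y h = 0 := by
  ext φ
  rw [H.derivAlong_apply, hY]
  change _ * ∫ x, (0 : 𝕜) ∂_ = (0 : 𝕜)
  simp

variable [BorelSpace V] [FiniteDimensional ℝ V]

theorem exists_isSplineConvolution (hF : IsRegularFace X r F) (hg : g ∈ distOn 𝕜 r) :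
    ∃ h : DistOver V 𝕜, IsSplineConvolution X r F g h := by
  obtain ⟨w, hw⟩ := hF.nonempty
  obtain ⟨hr, hpos⟩ := hF.flippedFamily_pos hw
  obtain ⟨h, hh⟩ := exists_dist_eq_integral_splineMeasure hr hpos hg
  rcases neg_one_pow_eq_or 𝕜 (negativeList X r F).card with h1 | h1
  · refine ⟨h, fun φ => ⟨integrable_translate_splineMeasure hr hpos hg φ, ?_⟩⟩
    rw [hh, h1, one_mul]
  · refine ⟨-h, fun φ => ⟨integrable_translate_splineMeasure hr hpos hg φ, ?_⟩⟩
    change - h φ = _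
    rw [hh, h1, neg_one_mul]

/-- Differentiating `T * g` along a sublist of `X \ r` removes the sublist from the spline. -/
theorem IsSplineConvolution.derivAlong_subset_apply (H : IsSplineConvolution X r F g h)
    (hF : IsRegularFace X r F) (hg : g ∈ distOn 𝕜 r) {S : Finset ι}
    (hS : S ⊆ outsideList X r) (φ : Test V) :
    derivAlong 𝕜 X S h φ = (-1) ^ (negativeList X r F \ S).card *
      ∫ x, g (translateTest x φ)
        ∂(splineMeasure (outsideList X r \ S) (flippedFamily X r F)) := by
  obtain ⟨w, hw⟩ := hF.nonempty
  obtain ⟨hr, hpos⟩ := hF.flippedFamily_pos hw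
  induction S using Finset.induction_on generalizing φ with
  | empty => simpa only [derivAlong_empty, Finset.sdiff_empty] using (H φ).2
  | insert i S hi ih =>
    have hiO : i ∈ outsideList X r := hS (Finset.mem_insert_self _ _)
    have hins : outsideList X r \ S = insert i (outsideList X r \ insert i S) := by
      ext j
      simp only [Finset.mem_insert, Finset.mem_sdiff]
      by_cases hj : j = i
      · subst hj
        tauto
      · tauto
    have hstep := integral_splineMeasure_insert_translate_lineDeriv
      (S := outsideList X r \ insert i S) (i := i) (by simp) hr
      (by rw [← hins]; exact fun j hj => hpos j (Finset.sdiff_subset hj)) hg φ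
    rw [derivAlong_insert X hi, Distribution.lineDerivOp_apply_apply, map_neg,
      ih ((Finset.subset_insert _ _).trans hS), hins]
    -- Flipping $X_i$ changes the sign of its derivative, which matches the loss of one factor $-1$
    -- when $i$ leaves the negative list.
    by_cases hneg : i ∈ negativeList X r F
    · have hc : X i = - flippedFamily X r F i := by
        rw [flippedFamily, if_pos hneg, neg_neg]
      have hcard : (negativeList X r F \ S).card
          = (negativeList X r F \ insert i S).card + 1 := by
        rw [← Finset.card_insert_of_notMem (a := i) (by simp)]
        congr 1
        ext j
        simp only [Finset.mem_insert, Finset.mem_sdiff]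
        by_cases hj : j = i
        · subst hj
          tauto
        · tauto
      have hd : (∂_{X i} φ : Test V) = -∂_{flippedFamily X r F i} φ := by
        ext y
        change _ = -(∂_{flippedFamily X r F i} φ : Test V) y
        rw [lineDeriv_test_apply, lineDeriv_test_apply, hc, map_neg]
      have ht : ∀ x, g (translateTest x (∂_{X i} φ))
          = - g (translateTest x (∂_{flippedFamily X r F i} φ)) := fun x => by
        rw [hd, ← map_neg]
        rfl
      simp only [ht]
      rw [integral_neg, hstep, hcard, pow_succ]
      ring
    · have hc : X i = flippedFamily X r F i := by
        rw [flippedFamily, if_neg hneg]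
      have hcard : negativeList X r F \ S = negativeList X r F \ insert i S := by
        ext j
        simp only [Finset.mem_insert, Finset.mem_sdiff]
        by_cases hj : j = i
        · subst hj
          tauto
        · tauto
      rw [hcard, hc, hstep]
      ring

/-- Removing every vector reduces the spline to the unit mass at the origin: the signed spline is a
fundamental solution of $\partial_{X\setminus r}$. -/
theorem IsSplineConvolution.derivAlong_outsideList (H : IsSplineConvolution X r F g h)
    (hF : IsRegularFace X r F) (hg : g ∈ distOn 𝕜 r) :
    derivAlong 𝕜 X (outsideList X r) h = g := by
  ext φ
  rw [H.derivAlong_subset_apply hF hg subset_rfl,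
    Finset.sdiff_eq_empty_iff_subset.2 negativeList_subset, Finset.sdiff_self,
    splineMeasure_empty, integral_dirac, translateTest_zero]
  simp

/-- After $\partial_{X\setminus r'}$ the spline uses only vectors of $r'$, up to sign, so its cone
lies in $r'$; adding $r\le r'$ stays there. -/
theorem IsSplineConvolution.derivAlong_mem_distOn (H : IsSplineConvolution X r F g h)
    (hF : IsRegularFace X r F) (hg : g ∈ distOn 𝕜 r) {r' : Submodule ℝ V} (hr : r ≤ r') :
    derivAlong 𝕜 X (outsideList X r') h ∈ distOn 𝕜 r' := by
  intro φ hφ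
  rw [H.derivAlong_subset_apply hF hg
    (fun i hi => mem_outsideList.2 fun h => mem_outsideList.1 hi (hr h))]
  refine mul_eq_zero_of_right _ (integral_eq_zero_of_ae ?_)
  filter_upwards [ae_splineMeasure_mem_cone _ _]
  rintro x ⟨t, -, rfl⟩
  refine hg _ fun y hy => hφ _ (r'.add_mem (r'.sum_mem fun i _ => r'.smul_mem _ ?_) (hr hy))
  have hi : X i ∈ r' := by
    have := (Finset.mem_sdiff.1 i.2).2
    rwa [mem_outsideList, not_not] at this
  rw [flippedFamily]
  split_ifs
  · exact r'.neg_mem hi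
  · exact hi

omit [BorelSpace V] [FiniteDimensional ℝ V] in
theorem derivAlong_faceComponent_eq_zero {r' : Submodule ℝ V} (hr : r ∈ rationalSubspaces X)
    (hrr' : ¬ r ≤ r') (H : h ∈ faceComponent 𝕜 X r F) :
    derivAlong 𝕜 X (outsideList X r') h = 0 := by
  obtain ⟨g, hg, hc⟩ := H
  exact hc.derivAlong_eq_zero (derivAlong_outsideList_eq_zero hr hrr' hg)

theorem faceComponent_subset_spaceG (hr : r ∈ rationalSubspaces X) (hF : IsRegularFace X r F)
    (H : h ∈ faceComponent 𝕜 X r F) : h ∈ spaceG 𝕜 X := by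
  intro r' _
  by_cases hrr' : r ≤ r'
  · obtain ⟨g, hg, hc⟩ := H
    have hg' := hg.1
    rw [spanOf_insideList hr] at hg'
    exact hc.derivAlong_mem_distOn hF hg' hrr'
  · rw [derivAlong_faceComponent_eq_zero hr hrr' H]
    exact zero_mem_distOn r'

theorem eq_zero_of_derivAlong_faceComponent_eq_zero (hr : r ∈ rationalSubspaces X)
    (hF : IsRegularFace X r F) (H : h ∈ faceComponent 𝕜 X r F)
    (h0 : derivAlong 𝕜 X (outsideList X r) h = 0) : h = 0 := by
  obtain ⟨g, hg, hc⟩ := H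
  have hg' := hg.1
  rw [spanOf_insideList hr] at hg'
  rw [hc.derivAlong_outsideList hF hg'] at h0
  subst h0
  exact hc.eq_zero

end Faces

/-! ### Existence and uniqueness of the decomposition -/

section Decomposition

variable {𝕜 : Type*} [RCLike 𝕜] {V : Type*} [NormedAddCommGroup V] [NormedSpace ℝ V]
  [FiniteDimensional ℝ V] [MeasurableSpace V] [BorelSpace V]
  {ι : Type*} [Fintype ι] {X : ι → V} {F : Submodule ℝ V → Set (Module.Dual ℝ V)}

/-- Peeling off a minimal $r\in U$ keeps `U` closed upwards, which ensures that the subtracted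
component is invisible to the operators of subspaces outside `U`. When `U` is empty, the operator
attached to $V$ is the identity and forces $f=0$. -/
theorem exists_sum_faceComponents (hX : Submodule.span ℝ (Set.range X) = ⊤)
    (hF : IsRegularCollection X F) (U : Finset (Submodule ℝ V))
    (hU : U ⊆ rationalSubspaces X)
    (hup : ∀ r ∈ U, ∀ r' ∈ rationalSubspaces X, r ≤ r' → r' ∈ U)
    (f : DistOver V 𝕜) (hf : f ∈ spaceG 𝕜 X)
    (hfU : ∀ r ∈ rationalSubspaces X, r ∉ U → derivAlong 𝕜 X (outsideList X r) f = 0) :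
    ∃ c : Submodule ℝ V → DistOver V 𝕜,
      (∀ r ∈ U, c r ∈ faceComponent 𝕜 X r (F r)) ∧ f = ∑ r ∈ U, c r := by
  induction hk : U.card generalizing U f with
  | zero =>
    rw [Finset.card_eq_zero] at hk
    subst hk
    have h := hfU ⊤ (top_mem_rationalSubspaces hX) (Finset.notMem_empty _)
    rw [outsideList_top, derivAlong_empty] at h
    exact ⟨0, by simp, by simpa using h⟩
  | succ k ih =>
    have hne : U.Nonempty := Finset.card_pos.1 (by omega)
    obtain ⟨r, hr, hmin⟩ := U.exists_minimal hne
    have hrR := hU hr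
    set g := derivAlong 𝕜 X (outsideList X r) f with hg
    have hgr : g ∈ distOn 𝕜 r := hf r hrR
    have hgD : g ∈ dahmenMicchelli 𝕜 X (insideList X r) := by
      refine ⟨by rwa [spanOf_insideList hrR], fun Y hY => ?_⟩
      have hdis : Disjoint Y (outsideList X r) := by
        rw [Finset.disjoint_left]
        exact fun i hi hi' => mem_outsideList.1 hi' (mem_insideList.1 (hY.prop.1 hi))
      rw [hg, ← derivAlong_union X hdis]
      have hle : spanOf X (insideList X r \ Y) ≤ r :=
        spanOf_le fun i hi => mem_insideList.1 (Finset.sdiff_subset hi)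
      have hnot : spanOf X (insideList X r \ Y) ∉ U := fun hmem =>
        hY.prop.2 (by rw [spanOf_insideList hrR]; exact le_antisymm hle (hmin hmem hle))
      -- With $s$ the span of $(X\cap r)\setminus Y$, minimality of $r$ puts $s$ outside `U`, and
      -- $X\setminus s\subseteq Y\cup(X\setminus r)$.
      refine derivAlong_eq_zero_of_subset (fun i hi => ?_)
        (hfU _ (spanOf_mem_rationalSubspaces _) hnot)
      rw [Finset.mem_union, mem_outsideList]
      by_contra hcon
      rw [not_or, not_not] at hcon
      exact mem_outsideList.1 hi
        (mem_spanOf (Finset.mem_sdiff.2 ⟨mem_insideList.2 hcon.2, hcon.1⟩))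
    obtain ⟨h, hh⟩ := exists_isSplineConvolution (hF r hrR) hgr
    have hc : h ∈ faceComponent 𝕜 X r (F r) := ⟨g, hgD, hh⟩
    obtain ⟨c, hc1, hc2⟩ := ih (U.erase r) ((Finset.erase_subset _ _).trans hU)
      (fun r₁ h₁ r₂ h₂ h₁₂ => by
        rw [Finset.mem_erase] at h₁ ⊢
        refine ⟨?_, hup r₁ h₁.2 r₂ h₂ h₁₂⟩
        rintro rfl
        exact h₁.1 (le_antisymm h₁₂ (hmin h₁.2 h₁₂)))
      (f - h) (fun r' hr' => by
        rw [map_sub]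
        exact distOn_sub_mem (hf r' hr')
          (faceComponent_subset_spaceG hrR (hF r hrR) hc r' hr'))
      (fun r' hr' hnot => by
        rw [map_sub]
        by_cases he : r' = r
        · subst he
          rw [hh.derivAlong_outsideList (hF r' hrR) hgr, ← hg, sub_self]
        · have hnU : r' ∉ U := fun h => hnot (Finset.mem_erase.2 ⟨he, h⟩)
          rw [hfU r' hr' hnU, derivAlong_faceComponent_eq_zero hrR
            (fun hle => hnU (hup r hr r' hr' hle)) hc, sub_zero])
      (by rw [Finset.card_erase_of_mem hr, hk]; rfl)
    refine ⟨Function.update c r h, fun r' hr' => ?_, ?_⟩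
    · by_cases he : r' = r
      · subst he
        rwa [Function.update_self]
      · rw [Function.update_of_ne he]
        exact hc1 r' (Finset.mem_erase.2 ⟨he, hr'⟩)
    · rw [← Finset.add_sum_erase _ _ hr, Function.update_self,
        Finset.sum_congr rfl fun r' hr' => Function.update_of_ne (Finset.ne_of_mem_erase hr') _ _,
        ← hc2, add_sub_cancel]

theorem exists_isFaceDecomposition (hX : Submodule.span ℝ (Set.range X) = ⊤)
    (hF : IsRegularCollection X F) {f : DistOver V 𝕜} (hf : f ∈ spaceG 𝕜 X) :
    ∃ c, IsFaceDecomposition X F f c := by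
  obtain ⟨c, hc1, hc2⟩ := exists_sum_faceComponents hX hF (rationalSubspaces X) subset_rfl
    (fun _ _ r' hr' _ => hr') f hf fun r hr hr' => absurd hr hr'
  refine ⟨fun r => c r.1, fun r => hc1 r.1 r.2, hc2.trans ?_⟩
  exact (Finset.sum_coe_sort (rationalSubspaces X) c).symm

/-- Take $r$ minimal with a nonzero difference of components. Applying $\partial_{X\setminus r}$ to
the zero sum kills the terms with $r'\not\le r$, and those with $r'<r$ vanish by minimality; on the
remaining component the operator is injective. -/
theorem IsFaceDecomposition.eq (hF : IsRegularCollection X F) {f : DistOver V 𝕜}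
    {c c' : {r // r ∈ rationalSubspaces X} → DistOver V 𝕜}
    (hc : IsFaceDecomposition X F f c) (hc' : IsFaceDecomposition X F f c') : c = c' := by
  by_contra hne
  have hd : ∀ r, c r - c' r ∈ faceComponent 𝕜 X r.1 (F r.1) := fun r =>
    faceComponent_sub_mem (hc.1 r) (hc'.1 r)
  have hsum : ∑ r, (c r - c' r) = 0 := by
    rw [Finset.sum_sub_distrib, ← hc.2, ← hc'.2, sub_self]
  have hne' : (Finset.univ.filter fun r => c r - c' r ≠ 0).Nonempty := by
    obtain ⟨r, hr⟩ := Function.ne_iff.1 hne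
    exact ⟨r, Finset.mem_filter.2 ⟨Finset.mem_univ _, sub_ne_zero.2 hr⟩⟩
  obtain ⟨r, hr, hmin⟩ := Finset.exists_minimal hne'
  refine (Finset.mem_filter.1 hr).2 (eq_zero_of_derivAlong_faceComponent_eq_zero r.2
    (hF r.1 r.2) (hd r) ?_)
  have h1 := congrArg (derivAlong 𝕜 X (outsideList X r.1)) hsum
  rw [map_sum, map_zero, Finset.sum_eq_single r] at h1
  · exact h1
  · intro r' _ hr'
    by_cases hle : r'.1 ≤ r.1
    · have h0 : c r' - c' r' = 0 := by
        by_contra h0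
        have hmem : r' ∈ Finset.univ.filter fun r => c r - c' r ≠ 0 :=
          Finset.mem_filter.2 ⟨Finset.mem_univ _, h0⟩
        exact hr' (le_antisymm hle (hmin hmem hle))
      rw [h0, map_zero]
    · exact derivAlong_faceComponent_eq_zero r'.2 hle (hd r')
  · exact fun h => absurd (Finset.mem_univ r) h

end Decomposition

end

section

open scoped Classical Pointwise

/-! ### Topes and the cones that carry the components -/

section Topes

variable {V : Type*} [NormedAddCommGroup V] [NormedSpace ℝ V] [FiniteDimensional ℝ V]
  {ι : Type*} [Fintype ι] {X : ι → V}

/-- A sublist that does not span is contained in a rational hyperplane. -/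
theorem exists_rational_hyperplane (hX : Submodule.span ℝ (Set.range X) = ⊤) {S : Finset ι}
    (hS : spanOf X S ≠ ⊤) :
    ∃ H ∈ rationalSubspaces X, Module.finrank ℝ H + 1 = Module.finrank ℝ V ∧
      spanOf X S ≤ H := by
  -- A maximal non-spanning sublist spans a hyperplane, since one further vector makes it span $V$.
  obtain ⟨T, hST, hT, hmax⟩ := exists_maximal_ge_of_wellFoundedGT
    (fun T : Finset ι => spanOf X T ≠ ⊤) S hS
  refine ⟨spanOf X T, spanOf_mem_rationalSubspaces T, ?_, spanOf_mono hST⟩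
  have hi : ∃ i, X i ∉ spanOf X T := by
    by_contra hcon
    push Not at hcon
    refine hT (top_le_iff.1 (hX ▸ Submodule.span_le.2 ?_))
    rintro _ ⟨i, rfl⟩
    exact hcon i
  obtain ⟨i, hi⟩ := hi
  have hins : spanOf X (insert i T) = ⊤ := by
    by_contra hne
    exact hi (mem_spanOf (hmax hne (Finset.subset_insert i T) (Finset.mem_insert_self i T)))
  have hsup : Submodule.span ℝ {X i} ⊔ spanOf X T = ⊤ := by
    rw [← hins, spanOf, spanOf, ← Submodule.span_union, Finset.coe_insert, Set.image_insert_eq,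
      Set.singleton_union]
  have h1 := Submodule.finrank_add_le_finrank_add_finrank (Submodule.span ℝ {X i}) (spanOf X T)
  rw [hsup, finrank_top] at h1
  have h2 : Module.finrank ℝ (Submodule.span ℝ {X i}) ≤ 1 := by
    have h := finrank_span_finset_le_card (R := ℝ) ({X i} : Finset V)
    rwa [Finset.coe_singleton, Finset.card_singleton] at h
  have h3 := Submodule.finrank_lt hT
  omega

theorem spanOf_eq_top_of_mem_topeRegion (hX : Submodule.span ℝ (Set.range X) = ⊤)
    {S : Finset ι} {y : V} (hy : y ∈ topeRegion X) (hyS : y ∈ spanOf X S) :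
    spanOf X S = ⊤ := by
  by_contra hne
  obtain ⟨H, hH, hrank, hle⟩ := exists_rational_hyperplane hX hne
  exact hy H hH hrank (hle hyS)

/-- The sum of `r` and the cone spanned by `X \ r` flipped along the face `F`. -/
def faceCone (X : ι → V) (r : Submodule ℝ V) (F : Set (Module.Dual ℝ V)) : Set V :=
  {y | ∃ t : outsideList X r → ℝ, 0 ≤ t ∧ y - ∑ i, t i • flippedFamily X r F i ∈ r}

variable {r : Submodule ℝ V} {F : Set (Module.Dual ℝ V)}

omit [FiniteDimensional ℝ V] in
theorem flippedFamily_of_mem {i : ι} (hi : X i ∈ r) : flippedFamily X r F i = X i :=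
  if_neg fun h => mem_outsideList.1 (negativeList_subset h) hi

omit [FiniteDimensional ℝ V] in
theorem flippedFamily_eq_or (i : ι) :
    flippedFamily X r F i = X i ∨ flippedFamily X r F i = - X i := by
  rw [flippedFamily]
  split_ifs
  · exact Or.inr rfl
  · exact Or.inl rfl

omit [FiniteDimensional ℝ V] in
theorem mem_faceCone_iff (hr : r ∈ rationalSubspaces X) {y : V} :
    y ∈ faceCone X r F ↔
      ∃ s : ι → ℝ, (∀ i ∈ outsideList X r, 0 ≤ s i) ∧ y = ∑ i, s i • flippedFamily X r F i := by
  have hsplit : ∀ s : ι → ℝ, ∑ i, s i • flippedFamily X r F i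
      = ∑ i ∈ insideList X r, s i • flippedFamily X r F i
        + ∑ i ∈ outsideList X r, s i • flippedFamily X r F i := fun s =>
    (Finset.sum_filter_add_sum_filter_not _ _ _).symm
  constructor
  · rintro ⟨t, ht, hy⟩
    have hy' := (spanOf_insideList hr).ge hy
    rw [spanOf, Submodule.mem_span_image_finset_iff_exists_fun] at hy'
    obtain ⟨a, ha⟩ := hy'
    obtain ⟨s, hs₁, hs₂⟩ : ∃ s : ι → ℝ, (∀ i : outsideList X r, s i = t i) ∧
        ∀ i : insideList X r, s i = a i :=
      ⟨fun i => if h : i ∈ outsideList X r then t ⟨i, h⟩ else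
        if h' : i ∈ insideList X r then a ⟨i, h'⟩ else 0, fun i => dif_pos i.2, fun i =>
        (dif_neg fun h => mem_outsideList.1 h (mem_insideList.1 i.2)).trans (dif_pos i.2)⟩
    refine ⟨s, fun i hi => (ht ⟨i, hi⟩).trans_eq (hs₁ ⟨i, hi⟩).symm, ?_⟩
    have h₁ : ∑ i ∈ outsideList X r, s i • flippedFamily X r F i
        = ∑ i : outsideList X r, t i • flippedFamily X r F i := by
      rw [← Finset.sum_coe_sort]
      exact Finset.sum_congr rfl fun i _ => by rw [hs₁]
    have h₂ : ∑ i ∈ insideList X r, s i • flippedFamily X r F i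
        = ∑ i : insideList X r, a i • X i := by
      rw [← Finset.sum_coe_sort]
      exact Finset.sum_congr rfl fun i _ => by
        rw [hs₂, flippedFamily_of_mem (mem_insideList.1 i.2)]
    rw [hsplit, h₁, h₂, ha, sub_add_cancel]
  · rintro ⟨s, hs, rfl⟩
    refine ⟨fun i => s i, fun i => hs i i.2, ?_⟩
    rw [hsplit, Finset.sum_coe_sort (outsideList X r)
      (fun i => s i • flippedFamily X r F i), add_sub_cancel_right]
    refine r.sum_mem fun i hi => r.smul_mem _ ?_
    rw [flippedFamily_of_mem (mem_insideList.1 hi)]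
    exact mem_insideList.1 hi

/-- A point off the rational hyperplanes lies in no proper rational span, so the vectors with
positive or unconstrained coefficient span $V$. The linear map they define is open, and those
coefficients can be varied freely near their values. -/
theorem faceCone_mem_nhds (hX : Submodule.span ℝ (Set.range X) = ⊤)
    (hr : r ∈ rationalSubspaces X) {y : V} (hy : y ∈ faceCone X r F)
    (hyX : y ∈ topeRegion X) : faceCone X r F ∈ 𝓝 y := by
  obtain ⟨s, hs, rfl⟩ := (mem_faceCone_iff hr).1 hy
  let S : Finset ι := Finset.univ.filter fun i => i ∈ outsideList X r → 0 < s i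
  have hzero : ∀ i ∉ S, s i = 0 := by
    intro i hi
    have hi' : ¬ (i ∈ outsideList X r → 0 < s i) := fun h =>
      hi (Finset.mem_filter.2 ⟨Finset.mem_univ _, h⟩)
    push Not at hi'
    exact le_antisymm hi'.2 (hs i hi'.1)
  have hmem : ∑ i, s i • flippedFamily X r F i ∈ spanOf X S := by
    refine Submodule.sum_mem _ fun i _ => ?_
    by_cases hi : i ∈ S
    · refine Submodule.smul_mem _ _ ?_
      rcases flippedFamily_eq_or (X := X) (r := r) (F := F) i with h | h <;> rw [h]
      · exact mem_spanOf hi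
      · exact Submodule.neg_mem _ (mem_spanOf hi)
    · rw [hzero i hi, zero_smul]
      exact Submodule.zero_mem _
  have htop := spanOf_eq_top_of_mem_topeRegion hX hyX hmem
  let A : (S → ℝ) →ₗ[ℝ] V :=
    Fintype.linearCombination ℝ fun i : S => flippedFamily X r F i
  have hA : ∀ a, A a = ∑ i : S, a i • flippedFamily X r F i := fun a => rfl
  have hsurj : Function.Surjective A := by
    rw [← LinearMap.range_eq_top, ← top_le_iff, ← htop]
    refine spanOf_le fun i hi => ?_
    have h1 : flippedFamily X r F i ∈ LinearMap.range A :=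
      ⟨Pi.single ⟨i, hi⟩ 1, by simp [A]⟩
    rcases flippedFamily_eq_or (X := X) (r := r) (F := F) i with h | h
    · rwa [h] at h1
    · rw [h] at h1
      exact (Submodule.neg_mem_iff _).1 h1
  have hopen := LinearMap.isOpenMap_of_finiteDimensional A hsurj
  let O : Set (S → ℝ) := {a | ∀ i : S, (i : ι) ∈ outsideList X r → 0 < a i}
  have hO : IsOpen O := by
    have : O = ⋂ i : S, {a | (i : ι) ∈ outsideList X r → 0 < a i} := by
      ext a
      simp [O]
    rw [this]
    refine isOpen_iInter_of_finite fun i => ?_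
    by_cases hi : (i : ι) ∈ outsideList X r
    · simpa [hi] using isOpen_lt continuous_const (continuous_apply i)
    · simp [hi]
  refine Filter.mem_of_superset ((hopen O hO).mem_nhds ⟨fun i => s i, fun i hi => ?_, ?_⟩) ?_
  · exact (Finset.mem_filter.1 i.2).2 hi
  · rw [hA, Finset.sum_coe_sort S (fun i => s i • flippedFamily X r F i)]
    refine Finset.sum_subset (Finset.subset_univ S) fun i _ hi => ?_
    rw [hzero i hi, zero_smul]
  · rintro _ ⟨a, ha, rfl⟩
    rw [mem_faceCone_iff hr]
    refine ⟨fun i => if h : i ∈ S then a ⟨i, h⟩ else 0, fun i hi => ?_, ?_⟩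
    · dsimp only
      split_ifs with h
      · exact (ha ⟨i, h⟩ hi).le
      · exact le_rfl
    · rw [hA, ← Finset.sum_subset (Finset.subset_univ S) fun i _ hi => by
          simp only [dif_neg hi, zero_smul], ← Finset.sum_coe_sort S]
      exact Finset.sum_congr rfl fun i _ => by simp only [dif_pos i.2]

/-- For `w` in the face, the part of the cone with $w<M$ lies in the sum of $r$ and a compact set,
which is closed and contained in the cone. -/
theorem isClosed_faceCone (hF : IsRegularFace X r F) : IsClosed (faceCone X r F) := by
  obtain ⟨w, hw⟩ := hF.nonempty
  obtain ⟨hr, hpos⟩ := hF.flippedFamily_pos hw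
  have hwc : Continuous w := LinearMap.continuous_of_finiteDimensional w
  refine isClosed_of_closure_subset fun y hy => ?_
  set M := w y + 1 with hM
  let B : Set V := (fun t : outsideList X r → ℝ => ∑ i, t i • flippedFamily X r F i) ''
    Set.Icc 0 (fun i => M / w (flippedFamily X r F i))
  have hB : IsClosed ((r : Set V) + B) :=
    (Submodule.closed_of_finiteDimensional r).add_right_of_isCompact
      (isCompact_Icc.image (continuous_coneMap _ _))
  have h1 : {x | w x < M} ∩ faceCone X r F ⊆ (r : Set V) + B := by
    rintro x ⟨hx, t, ht, hxt⟩
    refine ⟨_, hxt, _, ⟨t, coneMap_mem_box hpos ht ?_, rfl⟩, by simp⟩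
    have h2 := (Submodule.mem_dualAnnihilator w).1 hr _ hxt
    rw [map_sub, sub_eq_zero] at h2
    rw [← h2]
    exact (show w x < M from hx).le
  have h2 : y ∈ (r : Set V) + B := by
    refine closure_minimal h1 hB ((isOpen_lt hwc continuous_const).inter_closure ⟨?_, hy⟩)
    change w y < M
    linarith
  obtain ⟨z, hz, _, ⟨t, ht, rfl⟩, hzy⟩ := h2
  refine ⟨t, ht.1, ?_⟩
  rw [← hzy]
  simpa using hz

omit [FiniteDimensional ℝ V] in
theorem IsRegularFace.nonneg_of_mem_faceCone (hF : IsRegularFace X r F)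
    {w : Module.Dual ℝ V} (hw : w ∈ F) {y : V} (hy : y ∈ faceCone X r F) : 0 ≤ w y := by
  obtain ⟨hr, hpos⟩ := hF.flippedFamily_pos hw
  obtain ⟨t, ht, hyt⟩ := hy
  have h := (Submodule.mem_dualAnnihilator w).1 hr _ hyt
  rw [map_sub, sub_eq_zero] at h
  rw [h, map_sum]
  refine Finset.sum_nonneg fun i _ => ?_
  rw [map_smul]
  exact mul_nonneg (ht i) (hpos i i.2).le

/-- The interior of the cone and its complement are open and cover the connected tope. A point where
a form of the face is negative lies in the complement, so the interior cannot meet the tope as well.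
-/
theorem disjoint_tope_faceCone (hX : Submodule.span ℝ (Set.range X) = ⊤)
    (hr : r ∈ rationalSubspaces X) (hF : IsRegularFace X r F) {τ : Set V} (hτ : IsTope X τ)
    (hneg : ∃ u ∈ F, ∃ x ∈ τ, u x < 0) : Disjoint τ (faceCone X r F) := by
  obtain ⟨u, hu, x, hx, hux⟩ := hneg
  obtain ⟨x₀, -, rfl⟩ := hτ
  rw [Set.disjoint_left]
  intro y hy hyC
  have hsub := connectedComponentIn_subset (topeRegion X) x₀
  obtain ⟨z, -, hz1, hz2⟩ := isPreconnected_connectedComponentIn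
    (interior (faceCone X r F)) (faceCone X r F)ᶜ isOpen_interior
    (isClosed_faceCone hF).isOpen_compl
    (fun z hz => by
      by_cases h : z ∈ faceCone X r F
      · exact Or.inl (mem_interior_iff_mem_nhds.2 (faceCone_mem_nhds hX hr h (hsub hz)))
      · exact Or.inr h)
    ⟨y, hy, mem_interior_iff_mem_nhds.2 (faceCone_mem_nhds hX hr hyC (hsub hy))⟩
    ⟨x, hx, fun h => absurd (hF.nonneg_of_mem_faceCone hu h) (not_le.2 hux)⟩
  exact hz2 (interior_subset hz1)

end Topes

/-! ### Supports of the face components, and the component at $V$ -/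

section Localization

variable {𝕜 : Type*} [RCLike 𝕜] {V : Type*} [NormedAddCommGroup V] [NormedSpace ℝ V]
  [MeasurableSpace V] [BorelSpace V] {ι : Type*} [Fintype ι] {X : ι → V}

theorem faceComponent_apply_eq_zero {r : Submodule ℝ V} {F : Set (Module.Dual ℝ V)}
    (hr : r ∈ rationalSubspaces X) {h : DistOver V 𝕜} (H : h ∈ faceComponent 𝕜 X r F)
    {φ : Test V} (hφ : ∀ x ∈ faceCone X r F, φ x = 0) : h φ = 0 := by
  obtain ⟨g, hg, hc⟩ := H
  have hg' := hg.1
  rw [spanOf_insideList hr] at hg'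
  rw [(hc φ).2]
  refine mul_eq_zero_of_right _ (integral_eq_zero_of_ae ?_)
  filter_upwards [ae_splineMeasure_mem_cone _ _]
  rintro x ⟨t, ht, rfl⟩
  exact hg' _ fun y hy => hφ _ ⟨t, ht, by simpa using hy⟩

/-- For $r=V$ the spline of the empty list is the unit mass at $0$ with sign $+1$, so the
convolution changes nothing. -/
theorem faceComponent_top_subset [FiniteDimensional ℝ V] {F : Set (Module.Dual ℝ V)} {h : DistOver V 𝕜}
    (H : h ∈ faceComponent 𝕜 X ⊤ F) : h ∈ dahmenMicchelli 𝕜 X Finset.univ := by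
  obtain ⟨g, hg, hc⟩ := H
  have hneg : negativeList X ⊤ F = ∅ :=
    Finset.subset_empty.1 (negativeList_subset.trans outsideList_top.subset)
  have he : h = g := by
    ext φ
    rw [(hc φ).2, outsideList_top, splineMeasure_empty,
      integral_dirac (fun x => g (translateTest x φ)) 0, translateTest_zero, hneg]
    simp
  rwa [he, ← insideList_top (X := X)]

end Localization

end

theorem proposition4p4 {𝕜 : Type*} [RCLike 𝕜]
    {V : Type*} [NormedAddCommGroup V] [NormedSpace ℝ V] [FiniteDimensional ℝ V]
    [MeasurableSpace V] [BorelSpace V]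
    (μ : MeasureTheory.Measure V) [μ.IsAddHaarMeasure]
    {ι : Type*} [Fintype ι] (X : ι → V) (hX0 : ∀ i, X i ≠ 0)
    (hX : Submodule.span ℝ (Set.range X) = ⊤)
    (τ : Set V) (hτ : IsTope X τ)
    (F : Submodule ℝ V → Set (Module.Dual ℝ V)) (hF : IsRegularCollection X F)
    (hFτ : IsNonPositiveOn X F τ)
    (f : 𝓓'((⊤ : TopologicalSpace.Opens V), 𝕜)) (hf : f ∈ spaceG 𝕜 X) :
    ∃ c : {r // r ∈ rationalSubspaces X} → 𝓓'((⊤ : TopologicalSpace.Opens V), 𝕜),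
      (IsFaceDecomposition X F f c ∧ ∀ c', IsFaceDecomposition X F f c' → c' = c) ∧
      c ⟨⊤, top_mem_rationalSubspaces hX⟩ ∈ dahmenMicchelli 𝕜 X Finset.univ ∧
      IsPolynomialDensity μ (c ⟨⊤, top_mem_rationalSubspaces hX⟩) ∧
      ∀ φ : 𝓓((⊤ : TopologicalSpace.Opens V), ℝ), tsupport φ ⊆ τ →
        f φ = c ⟨⊤, top_mem_rationalSubspaces hX⟩ φ := by
  classical
  obtain ⟨c, hc⟩ := exists_isFaceDecomposition hX hF hf
  have hD := faceComponent_top_subset (hc.1 ⟨⊤, top_mem_rationalSubspaces hX⟩)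
  refine ⟨c, ⟨hc, fun c' hc' => hc'.eq hF hc⟩, hD, ?_, fun φ hφ => ?_⟩
  · have h := derivsVanish_derivAlong_of_mem_dahmenMicchelli hX hD Finset.univ
    rw [Finset.sdiff_self, derivAlong_empty] at h
    exact h.isPolynomialDensity μ
  · rw [hc.2, FunLike.coe_sum, Finset.sum_apply]
    refine Finset.sum_eq_single _ (fun r _ hr => ?_) fun h => absurd (Finset.mem_univ _) h
    have hne : r.1 ≠ ⊤ := fun h => hr (Subtype.ext h)
    have hdis := disjoint_tope_faceCone hX r.2 (hF r.1 r.2) hτ (hFτ r.1 r.2 hne)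
    refine faceComponent_apply_eq_zero r.2 (hc.1 r) fun x hx => ?_
    exact image_eq_zero_of_notMem_tsupport fun h => Set.disjoint_left.1 hdis (hφ h) hx
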